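/- **The system PHOML.** Fix three disjoint infinite sets of term variables $x,y$, proof variables $p,q$ and path variables $e$. Types, terms, proofs, paths and contexts are given by $$\begin{array}{rcl} A,B &::=& \Omega \mid A\to B\\ L,M,N,\varphi,\psi,\chi &::=& x\mid\bot\mid\varphi\supset\psi\mid\lambda x{:}A.M\mid MN\\ \delta,\epsilon &::=& p\mid\lambda p{:}\varphi.\delta\mid\delta\epsilon\mid P^+\mid P^-\\ P,Q &::=& e\mid\mathsf{ref}(M)\mid P\supset^*Q\mid\mathsf{univ}_{\varphi,\psi}(\delta,\epsilon)\mid\lambda\!\!\lambda\!\!\lambda e{:}x=_Ay.P\mid P_{MN}Q\\ \Gamma &::=& \langle\rangle\mid\Gamma,x{:}A\mid\Gamma,p{:}\varphi\mid\Gamma,e{:}M=_AN \end{array}$$ where $\lambda\!\!\lambda\!\!\lambda e{:}x=_Ay.P$ (with $x\ne y$) binds $e,x,y$ in $P$, expressions are identified up to $\alpha$-conversion, and the variables declared in a context are distinct. *Path substitution.* $L\{\tau\}=L\{\vec x:=\vec P:\vec M=\vec N\}$ is the path defined by $x_i\{\tau\}=P_i$; $y\{\tau\}=\mathsf{ref}(y)$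 for other variables $y$; $\bot\{\tau\}=\mathsf{ref}(\bot)$; $(\varphi\supset\psi)\{\tau\}=\varphi\{\tau\}\supset^*\psi\{\tau\}$; $(LL')\{\tau\}=L\{\tau\}_{L'[\vec x:=\vec M]\,L'[\vec x:=\vec N]}L'\{\tau\}$; $(\lambda y{:}A.L)\{\tau\}=\lambda\!\!\lambda\!\!\lambda e{:}a=_Aa'.\,L\{\tau,\,y:=e:a=a'\}$, with $e,a,a'$ fresh. *Reduction* $\to$ is the least relation with: on terms, $(\lambda x{:}A.M)N\to M[x:=N]$; and if $M\to M'$ then $MN\to M'N$, $M\supset\psi\to M'\supset\psi$ and $\varphi\supset M\to\varphi\supset M'$; on proofs, $(\lambda p{:}\varphi.\delta)\epsilon\to\delta[p:=\epsilon]$, $\mathsf{ref}(\varphi)^{\pm}\to\lambda p{:}\varphi.p$, $\mathsf{univ}_{\varphi,\psi}(\delta,\epsilon)^+\to\delta$, $\mathsf{univ}_{\varphi,\psi}(\delta,\epsilon)^-\to\epsilon$; if $\delta\to\delta'$ then $\delta\epsilon\to\delta'\epsilon$; if $P\to Q$ then $P^{\pm}\to Q^{\pm}$; on paths, $(\lambda\!\!\lambda\!\!\lambda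 e{:}x=_Ay.P)_{MN}Q\to P[x:=M,y:=N,e:=Q]$; $\mathsf{ref}(\lambda x{:}A.M)_{NN'}P\to M\{x:=P:N=N'\}$; $\mathsf{ref}(\varphi)\supset^*\mathsf{ref}(\psi)\to\mathsf{ref}(\varphi\supset\psi)$; $\mathsf{ref}(\varphi)\supset^*\mathsf{univ}_{\psi,\chi}(\delta,\epsilon)\to\mathsf{univ}_{\varphi\supset\psi,\,\varphi\supset\chi}(\lambda p{:}\varphi\supset\psi.\lambda q{:}\varphi.\delta(pq),\ \lambda p{:}\varphi\supset\chi.\lambda q{:}\varphi.\epsilon(pq))$; $\mathsf{univ}_{\varphi,\psi}(\delta,\epsilon)\supset^*\mathsf{ref}(\chi)\to\mathsf{univ}_{\varphi\supset\chi,\,\psi\supset\chi}(\lambda p{:}\varphi\supset\chi.\lambda q{:}\psi.p(\epsilon q),\ \lambda p{:}\psi\supset\chi.\lambda q{:}\varphi.p(\delta q))$; $\mathsf{univ}_{\varphi,\psi}(\delta,\epsilon)\supset^*\mathsf{univ}_{\varphi',\psi'}(\delta',\epsilon')\to\mathsf{univ}_{\varphi\supset\varphi',\,\psi\supset\psi'}(\lambda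 p{:}\varphi\supset\varphi'.\lambda q{:}\psi.\delta'(p(\epsilon q)),\ \lambda p{:}\psi\supset\psi'.\lambda q{:}\varphi.\epsilon'(p(\delta q)))$; if $P\to P'$ then $P_{MN}Q\to P'_{MN}Q$, $P\supset^*Q\to P'\supset^*Q$ and $Q\supset^*P\to Q\supset^*P'$; if $M\to M'$ then $\mathsf{ref}(M)_{NN'}P\to\mathsf{ref}(M')_{NN'}P$. "Reduces to" means the reflexive transitive closure of $\to$, and $\simeq$ is its reflexive symmetric transitive closure. *Rules of deduction.* The judgements $\Gamma\vdash\mathrm{valid}$, $\Gamma\vdash M:A$, $\Gamma\vdash\delta:\varphi$ and $\Gamma\vdash P:M=_AN$ are generated by the following rules. - Contexts and variables: $\langle\rangle\vdash\mathrm{valid}$; $\Gamma,x{:}A\vdash\mathrm{valid}$ if $\Gamma\vdash\mathrm{valid}$; $\Gamma,p{:}\varphi\vdash\mathrm{valid}$ if $\Gamma\vdash\varphi:\Omega$; $\Gamma,e{:}M=_AN\vdash\mathrm{valid}$ if $\Gamma\vdash M:A$ and $\Gamma\vdash N:A$; if $\Gamma\vdash\mathrm{valid}$, then $\Gamma\vdash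 z:T$ for each entry $z:T$ of $\Gamma$. - Terms: $\Gamma\vdash\bot:\Omega$ if $\Gamma\vdash\mathrm{valid}$; $\Gamma\vdash\varphi\supset\psi:\Omega$ if $\Gamma\vdash\varphi:\Omega$ and $\Gamma\vdash\psi:\Omega$; $\Gamma\vdash MN:B$ if $\Gamma\vdash M:A\to B$ and $\Gamma\vdash N:A$; $\Gamma\vdash\lambda x{:}A.M:A\to B$ if $\Gamma,x{:}A\vdash M:B$. - Proofs: $\Gamma\vdash\delta\epsilon:\psi$ if $\Gamma\vdash\delta:\varphi\supset\psi$ and $\Gamma\vdash\epsilon:\varphi$; $\Gamma\vdash\lambda p{:}\varphi.\delta:\varphi\supset\psi$ if $\Gamma,p{:}\varphi\vdash\delta:\psi$; $\Gamma\vdash P^+:\varphi\supset\psi$ and $\Gamma\vdash P^-:\psi\supset\varphi$ if $\Gamma\vdash P:\varphi=_\Omega\psi$; $\Gamma\vdash\delta:\psi$ if $\Gamma\vdash\delta:\varphi$, $\Gamma\vdash\psi:\Omega$ and $\varphi\simeq\psi$. - Paths: $\Gamma\vdash\mathsf{ref}(M):M=_AM$ if $\Gamma\vdash M:A$; $\Gamma\vdash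 P\supset^*Q:\varphi\supset\psi=_\Omega\varphi'\supset\psi'$ if $\Gamma\vdash P:\varphi=_\Omega\varphi'$ and $\Gamma\vdash Q:\psi=_\Omega\psi'$; $\Gamma\vdash\mathsf{univ}_{\varphi,\psi}(\delta,\epsilon):\varphi=_\Omega\psi$ if $\Gamma\vdash\delta:\varphi\supset\psi$ and $\Gamma\vdash\epsilon:\psi\supset\varphi$; $\Gamma\vdash\lambda\!\!\lambda\!\!\lambda e{:}x=_Ay.P:M=_{A\to B}N$ if $\Gamma,x{:}A,y{:}A,e{:}x=_Ay\vdash P:Mx=_BNy$, $\Gamma\vdash M:A\to B$ and $\Gamma\vdash N:A\to B$; $\Gamma\vdash P_{NN'}Q:MN=_BM'N'$ if $\Gamma\vdash P:M=_{A\to B}M'$, $\Gamma\vdash Q:N=_AN'$, $\Gamma\vdash N:A$ and $\Gamma\vdash N':A$; $\Gamma\vdash P:M'=_AN'$ if $\Gamma\vdash P:M=_AN$, $\Gamma\vdash M':A$, $\Gamma\vdash N':A$, $M\simeq M'$ and $N\simeq N'$. *Canonical and neutral.* A canonical proof is one of the form $\lambda p{:}\varphi.\delta$; a canonical path is one of the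 form $\mathsf{ref}(M)$, $\mathsf{univ}_{\varphi,\psi}(\delta,\epsilon)$ or $\lambda\!\!\lambda\!\!\lambda e{:}x=_Ay.P$. Neutral proofs $\delta_n$ and neutral paths $P_n$ are given by $$\delta_n::=p\mid P_n^+\mid P_n^-\mid\delta_n\,\epsilon,\qquad P_n::=e\mid P_n\supset^*Q\mid Q\supset^*P_n\mid(P_n)_{MN}Q .$$ **Corollary.** Let $\Gamma$ be a context in which no term variables occur (no entry of $\Gamma$ is of the form $x:A$). 1. If $\Gamma\vdash\delta:\varphi$, then $\delta$ reduces to a neutral proof or to a canonical proof. 2. If $\Gamma\vdash P:M=_AN$, then $P$ reduces to a neutral path or to a canonical path. -/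

import Mathlib

/-
Syntax, reduction and typing of PHOML (predicative higher-order minimal logic).

Expressions up to alpha-conversion are represented by de Bruijn indices.  There are three
separate index spaces: term variables, proof variables and path variables; index `0` of a kind
is the most recently bound (or declared) variable of that kind.
-/

namespace PHOML

/-- The simple types over `Ω`. -/
inductive Ty : Type
  | Omega : Ty
  | arrow (A B : Ty) : Ty

/-- Terms `x | ⊥ | φ ⊃ ψ | λ x:A. M | M N`. -/
inductive Tm : Type
  | var (x : ℕ) : Tm
  | bot : Tm
  | imp (φ ψ : Tm) : Tm
  /-- `λ x:A. M`, binding term variable `0` in `M`. -/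
  | lam (A : Ty) (M : Tm) : Tm
  | app (M N : Tm) : Tm

mutual
/-- Proofs `p | λ p:φ. δ | δ ε | P⁺ | P⁻`. -/
inductive Prf : Type
  | var (p : ℕ) : Prf
  /-- `λ p:φ. δ`, binding proof variable `0` in `δ`. -/
  | lam (φ : Tm) (δ : Prf) : Prf
  | app (δ ε : Prf) : Prf
  | plus (P : Pth) : Prf
  | minus (P : Pth) : Prf
/-- Paths `e | ref M | P ⊃* Q | univ φ ψ δ ε | λλλ e : x =_A y. P | P_{MN} Q`. -/
inductive Pth : Type
  | var (e : ℕ) : Pth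
  | ref (M : Tm) : Pth
  | imp (P Q : Pth) : Pth
  | univ (φ ψ : Tm) (δ ε : Prf) : Pth
  /-- `λλλ e : x =_A y. P`; in `P` the variable `x` is term variable `1`, the variable `y` is
  term variable `0`, and `e` is path variable `0`. -/
  | lll (A : Ty) (P : Pth) : Pth
  /-- `app P M N Q` is `P_{MN} Q`. -/
  | app (P : Pth) (M N : Tm) (Q : Pth) : Pth
end

/-! ### Renaming and substitution -/

/-- The extension of a renaming of one kind of variables under a binder of that kind. -/
def up (ξ : ℕ → ℕ) : ℕ → ℕ
  | 0 => 0
  | n + 1 => ξ n + 1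

def Tm.rename (ξ : ℕ → ℕ) : Tm → Tm
  | .var x => .var (ξ x)
  | .bot => .bot
  | .imp φ ψ => .imp (φ.rename ξ) (ψ.rename ξ)
  | .lam A M => .lam A (M.rename (up ξ))
  | .app M N => .app (M.rename ξ) (N.rename ξ)

mutual
/-- Rename term variables by `a`, proof variables by `b`, path variables by `c`. -/
def Prf.rename (a b c : ℕ → ℕ) : Prf → Prf
  | .var p => .var (b p)
  | .lam φ δ => .lam (φ.rename a) (δ.rename a (up b) c)
  | .app δ ε => .app (δ.rename a b c) (ε.rename a b c)
  | .plus P => .plus (P.rename a b c)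
  | .minus P => .minus (P.rename a b c)
/-- Rename term variables by `a`, proof variables by `b`, path variables by `c`. -/
def Pth.rename (a b c : ℕ → ℕ) : Pth → Pth
  | .var e => .var (c e)
  | .ref M => .ref (M.rename a)
  | .imp P Q => .imp (P.rename a b c) (Q.rename a b c)
  | .univ φ ψ δ ε => .univ (φ.rename a) (ψ.rename a) (δ.rename a b c) (ε.rename a b c)
  | .lll A P => .lll A (P.rename (up (up a)) b (up c))
  | .app P M N Q => .app (P.rename a b c) (M.rename a) (N.rename a) (Q.rename a b c)
end

/-- The extension of a family of terms under a binder of a term variable. -/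
def Tm.upSub (s : ℕ → Tm) : ℕ → Tm
  | 0 => .var 0
  | n + 1 => (s n).rename (· + 1)

/-- Simultaneous capture-avoiding substitution in a term. -/
def Tm.subst (s : ℕ → Tm) : Tm → Tm
  | .var x => s x
  | .bot => .bot
  | .imp φ ψ => .imp (φ.subst s) (ψ.subst s)
  | .lam A M => .lam A (M.subst (Tm.upSub s))
  | .app M N => .app (M.subst s) (N.subst s)

/-- A substitution maps term variables to terms, proof variables to proofs and path variables
to paths. -/
structure Sub : Type where
  tm : ℕ → Tm
  prf : ℕ → Prf
  pth : ℕ → Pth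

/-- The extension of a substitution under a binder of a proof variable. -/
def Sub.upPrf (σ : Sub) : Sub where
  tm := σ.tm
  prf := fun n => match n with
    | 0 => .var 0
    | n + 1 => (σ.prf n).rename id (· + 1) id
  pth := fun n => (σ.pth n).rename id (· + 1) id

/-- The extension of a substitution under the binder `λλλ` (two term variables and a path
variable). -/
def Sub.upLll (σ : Sub) : Sub where
  tm := Tm.upSub (Tm.upSub σ.tm)
  prf := fun n => (σ.prf n).rename (· + 2) id (· + 1)
  pth := fun n => match n with
    | 0 => .var 0
    | n + 1 => (σ.pth n).rename (· + 2) id (· + 1)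

mutual
/-- Simultaneous capture-avoiding substitution in a proof. -/
def Prf.subst (σ : Sub) : Prf → Prf
  | .var p => σ.prf p
  | .lam φ δ => .lam (φ.subst σ.tm) (δ.subst σ.upPrf)
  | .app δ ε => .app (δ.subst σ) (ε.subst σ)
  | .plus P => .plus (P.subst σ)
  | .minus P => .minus (P.subst σ)
/-- Simultaneous capture-avoiding substitution in a path. -/
def Pth.subst (σ : Sub) : Pth → Pth
  | .var e => σ.pth e
  | .ref M => .ref (M.subst σ.tm)
  | .imp P Q => .imp (P.subst σ) (Q.subst σ)
  | .univ φ ψ δ ε => .univ (φ.subst σ.tm) (ψ.subst σ.tm) (δ.subst σ) (ε.subst σ)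
  | .lll A P => .lll A (P.subst σ.upLll)
  | .app P M N Q => .app (P.subst σ) (M.subst σ.tm) (N.subst σ.tm) (Q.subst σ)
end

/-- The family sending term variable `0` to `N`, and every other variable to itself. -/
def Tm.single (N : Tm) : ℕ → Tm
  | 0 => N
  | n + 1 => .var n

/-- `M[x := N]`, where `x` is term variable `0`. -/
def Tm.inst (M N : Tm) : Tm := M.subst (Tm.single N)

/-- The substitution `[p := ε]`, where `p` is proof variable `0`. -/
def Sub.singlePrf (ε : Prf) : Sub where
  tm := .var
  prf := fun n => match n with
    | 0 => ε
    | n + 1 => .var n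
  pth := .var

/-- The substitution `[x := M, y := N, e := Q]`, where `x` is term variable `1`, `y` is term
variable `0`, and `e` is path variable `0`. -/
def Sub.triple (M N : Tm) (Q : Pth) : Sub where
  tm := fun n => match n with
    | 0 => N
    | 1 => M
    | n + 2 => .var n
  prf := .var
  pth := fun n => match n with
    | 0 => Q
    | n + 1 => .var n

/-! ### Path substitution -/

/-- The path substitution family under the binder `λλλ e : a =_A a'`: the variable bound in the
original term is sent to `e`. -/
def upPath (τ : ℕ → Pth) : ℕ → Pth
  | 0 => .var 0
  | n + 1 => (τ n).rename (· + 2) id (· + 1)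

/-- The left endpoints under the binder `λλλ e : a =_A a'`: the new variable is sent to `a`. -/
def upLeft (ρ : ℕ → Tm) : ℕ → Tm
  | 0 => .var 1
  | n + 1 => (ρ n).rename (· + 2)

/-- The right endpoints under the binder `λλλ e : a =_A a'`: the new variable is sent to
the second variable. -/
def upRight (σ : ℕ → Tm) : ℕ → Tm
  | 0 => .var 0
  | n + 1 => (σ n).rename (· + 2)

/-- `L.pathSubst τ ρ σ` is the path `L {τ : ρ = σ}`.  The families are total: a variable `y`
outside the intended domain is to be sent to `ref y` by `τ`, and to `y` by `ρ` and `σ`. -/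
def Tm.pathSubst (τ : ℕ → Pth) (ρ σ : ℕ → Tm) : Tm → Pth
  | .var x => τ x
  | .bot => .ref .bot
  | .imp φ ψ => .imp (φ.pathSubst τ ρ σ) (ψ.pathSubst τ ρ σ)
  | .lam A L => .lll A (L.pathSubst (upPath τ) (upLeft ρ) (upRight σ))
  | .app L L' =>
      .app (L.pathSubst τ ρ σ) (L'.subst ρ) (L'.subst σ) (L'.pathSubst τ ρ σ)

/-- The family sending term variable `0` to `P`, and every other term variable `y` to `ref y`. -/
def Pth.single (P : Pth) : ℕ → Pth
  | 0 => P
  | n + 1 => .ref (.var n)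

/-- `M {x := P : N = N'}`, where `x` is term variable `0`. -/
def Tm.pathInst (M : Tm) (P : Pth) (N N' : Tm) : Pth :=
  M.pathSubst (Pth.single P) (Tm.single N) (Tm.single N')

/-! ### Call-by-name reduction -/

/-- One-step reduction of terms. -/
inductive Tm.Red : Tm → Tm → Prop
  | beta (A : Ty) (M N : Tm) : Tm.Red (.app (.lam A M) N) (M.inst N)
  | app {M M' : Tm} (N : Tm) : Tm.Red M M' → Tm.Red (.app M N) (.app M' N)
  | impL {φ φ' : Tm} (ψ : Tm) : Tm.Red φ φ' → Tm.Red (.imp φ ψ) (.imp φ' ψ)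
  | impR (φ : Tm) {ψ ψ' : Tm} : Tm.Red ψ ψ' → Tm.Red (.imp φ ψ) (.imp φ ψ')

/-- Weakening of a proof by two proof variables. -/
def Prf.wk2 (δ : Prf) : Prf := δ.rename id (· + 2) id

/-- One-step reduction of paths. -/
inductive Pth.Red : Pth → Pth → Prop
  | beta (A : Ty) (P : Pth) (M N : Tm) (Q : Pth) :
      Pth.Red (.app (.lll A P) M N Q) (P.subst (Sub.triple M N Q))
  | refLam (A : Ty) (M N N' : Tm) (P : Pth) :
      Pth.Red (.app (.ref (.lam A M)) N N' P) (M.pathInst P N N')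
  | refRef (φ ψ : Tm) : Pth.Red (.imp (.ref φ) (.ref ψ)) (.ref (.imp φ ψ))
  /-- `ref φ ⊃* univ ψ χ δ ε → univ (φ ⊃ ψ) (φ ⊃ χ) (λ p. λ q. δ (p q)) (λ p. λ q. ε (p q))` -/
  | refUniv (φ ψ χ : Tm) (δ ε : Prf) :
      Pth.Red (.imp (.ref φ) (.univ ψ χ δ ε))
        (.univ (.imp φ ψ) (.imp φ χ)
          (.lam (.imp φ ψ) (.lam φ (.app δ.wk2 (.app (.var 1) (.var 0)))))
          (.lam (.imp φ χ) (.lam φ (.app ε.wk2 (.app (.var 1) (.var 0))))))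
  /-- `univ φ ψ δ ε ⊃* ref χ → univ (φ ⊃ χ) (ψ ⊃ χ) (λ p. λ q. p (ε q)) (λ p. λ q. p (δ q))` -/
  | univRef (φ ψ χ : Tm) (δ ε : Prf) :
      Pth.Red (.imp (.univ φ ψ δ ε) (.ref χ))
        (.univ (.imp φ χ) (.imp ψ χ)
          (.lam (.imp φ χ) (.lam ψ (.app (.var 1) (.app ε.wk2 (.var 0)))))
          (.lam (.imp ψ χ) (.lam φ (.app (.var 1) (.app δ.wk2 (.var 0))))))
  /-- `univ φ ψ δ ε ⊃* univ φ' ψ' δ' ε'` reduces to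
  `univ (φ ⊃ φ') (ψ ⊃ ψ') (λ p. λ q. δ' (p (ε q))) (λ p. λ q. ε' (p (δ q)))`. -/
  | univUniv (φ ψ φ' ψ' : Tm) (δ ε δ' ε' : Prf) :
      Pth.Red (.imp (.univ φ ψ δ ε) (.univ φ' ψ' δ' ε'))
        (.univ (.imp φ φ') (.imp ψ ψ')
          (.lam (.imp φ φ')
            (.lam ψ (.app δ'.wk2 (.app (.var 1) (.app ε.wk2 (.var 0))))))
          (.lam (.imp ψ ψ')
            (.lam φ (.app ε'.wk2 (.app (.var 1) (.app δ.wk2 (.var 0)))))))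
  | app {P P' : Pth} (M N : Tm) (Q : Pth) :
      Pth.Red P P' → Pth.Red (.app P M N Q) (.app P' M N Q)
  | appRef {M M' : Tm} (N N' : Tm) (P : Pth) :
      Tm.Red M M' → Pth.Red (.app (.ref M) N N' P) (.app (.ref M') N N' P)
  | impL {P P' : Pth} (Q : Pth) : Pth.Red P P' → Pth.Red (.imp P Q) (.imp P' Q)
  | impR (P : Pth) {Q Q' : Pth} : Pth.Red Q Q' → Pth.Red (.imp P Q) (.imp P Q')

/-- One-step reduction of proofs. -/
inductive Prf.Red : Prf → Prf → Prop
  | beta (φ : Tm) (δ ε : Prf) :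
      Prf.Red (.app (.lam φ δ) ε) (δ.subst (Sub.singlePrf ε))
  | refPlus (φ : Tm) : Prf.Red (.plus (.ref φ)) (.lam φ (.var 0))
  | refMinus (φ : Tm) : Prf.Red (.minus (.ref φ)) (.lam φ (.var 0))
  | app {δ δ' : Prf} (ε : Prf) : Prf.Red δ δ' → Prf.Red (.app δ ε) (.app δ' ε)
  | univPlus (φ ψ : Tm) (δ ε : Prf) : Prf.Red (.plus (.univ φ ψ δ ε)) δ
  | univMinus (φ ψ : Tm) (δ ε : Prf) : Prf.Red (.minus (.univ φ ψ δ ε)) ε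
  | plus {P Q : Pth} : Pth.Red P Q → Prf.Red (.plus P) (.plus Q)
  | minus {P Q : Pth} : Pth.Red P Q → Prf.Red (.minus P) (.minus Q)

/-- Reduction of proofs in zero or more steps. -/
def Prf.Reds : Prf → Prf → Prop := Relation.ReflTransGen Prf.Red

/-- Reduction of paths in zero or more steps. -/
def Pth.Reds : Pth → Pth → Prop := Relation.ReflTransGen Pth.Red

/-- Convertibility `M ≃ N` of terms: the reflexive symmetric transitive closure of reduction. -/
def Tm.Conv : Tm → Tm → Prop := Relation.EqvGen Tm.Red

/-! ### Contexts and rules of deduction -/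

/-- Contexts `⟨⟩ | Γ, x : A | Γ, p : φ | Γ, e : M =_A N`. -/
inductive Ctx : Type
  | nil : Ctx
  | tm (Γ : Ctx) (A : Ty) : Ctx
  | prf (Γ : Ctx) (φ : Tm) : Ctx
  | pth (Γ : Ctx) (M : Tm) (A : Ty) (N : Tm) : Ctx

/-- Weakening of a term by one term variable. -/
def Tm.wk (M : Tm) : Tm := M.rename (· + 1)

/-- `Γ.HasTm x A` means `x : A ∈ Γ`. -/
inductive Ctx.HasTm : Ctx → ℕ → Ty → Prop
  | here (Γ : Ctx) (A : Ty) : Ctx.HasTm (.tm Γ A) 0 A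
  | tm {Γ : Ctx} {x : ℕ} {A : Ty} (B : Ty) :
      Ctx.HasTm Γ x A → Ctx.HasTm (.tm Γ B) (x + 1) A
  | prf {Γ : Ctx} {x : ℕ} {A : Ty} (φ : Tm) :
      Ctx.HasTm Γ x A → Ctx.HasTm (.prf Γ φ) x A
  | pth {Γ : Ctx} {x : ℕ} {A : Ty} (M : Tm) (B : Ty) (N : Tm) :
      Ctx.HasTm Γ x A → Ctx.HasTm (.pth Γ M B N) x A

/-- `Γ.HasPrf p φ` means `p : φ ∈ Γ`. -/
inductive Ctx.HasPrf : Ctx → ℕ → Tm → Prop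
  | here (Γ : Ctx) (φ : Tm) : Ctx.HasPrf (.prf Γ φ) 0 φ
  | tm {Γ : Ctx} {p : ℕ} {φ : Tm} (B : Ty) :
      Ctx.HasPrf Γ p φ → Ctx.HasPrf (.tm Γ B) p φ.wk
  | prf {Γ : Ctx} {p : ℕ} {φ : Tm} (ψ : Tm) :
      Ctx.HasPrf Γ p φ → Ctx.HasPrf (.prf Γ ψ) (p + 1) φ
  | pth {Γ : Ctx} {p : ℕ} {φ : Tm} (M : Tm) (B : Ty) (N : Tm) :
      Ctx.HasPrf Γ p φ → Ctx.HasPrf (.pth Γ M B N) p φ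

/-- `Γ.HasPth e M A N` means `e : M =_A N ∈ Γ`. -/
inductive Ctx.HasPth : Ctx → ℕ → Tm → Ty → Tm → Prop
  | here (Γ : Ctx) (M : Tm) (A : Ty) (N : Tm) : Ctx.HasPth (.pth Γ M A N) 0 M A N
  | tm {Γ : Ctx} {e : ℕ} {M : Tm} {A : Ty} {N : Tm} (B : Ty) :
      Ctx.HasPth Γ e M A N → Ctx.HasPth (.tm Γ B) e M.wk A N.wk
  | prf {Γ : Ctx} {e : ℕ} {M : Tm} {A : Ty} {N : Tm} (ψ : Tm) :
      Ctx.HasPth Γ e M A N → Ctx.HasPth (.prf Γ ψ) e M A N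
  | pth {Γ : Ctx} {e : ℕ} {M : Tm} {A : Ty} {N : Tm} (M' : Tm) (B : Ty) (N' : Tm) :
      Ctx.HasPth Γ e M A N → Ctx.HasPth (.pth Γ M' B N') (e + 1) M A N

/-- What may stand to the right of the turnstile: `valid`, `M : A`, `δ : φ`, `P : M =_A N`. -/
inductive Jdg : Type
  | valid : Jdg
  | tm (M : Tm) (A : Ty) : Jdg
  | prf (δ : Prf) (φ : Tm) : Jdg
  | pth (P : Pth) (M : Tm) (A : Ty) (N : Tm) : Jdg

/-- Derivability of judgements `Γ ⊢ J`. -/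
inductive Derives : Ctx → Jdg → Prop
  | ctxNil : Derives .nil .valid
  | ctxT {Γ : Ctx} (A : Ty) : Derives Γ .valid → Derives (.tm Γ A) .valid
  | ctxP {Γ : Ctx} {φ : Tm} : Derives Γ (.tm φ .Omega) → Derives (.prf Γ φ) .valid
  | ctxE {Γ : Ctx} {M N : Tm} {A : Ty} :
      Derives Γ (.tm M A) → Derives Γ (.tm N A) → Derives (.pth Γ M A N) .valid
  | varT {Γ : Ctx} {x : ℕ} {A : Ty} :
      Derives Γ .valid → Γ.HasTm x A → Derives Γ (.tm (.var x) A)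
  | varP {Γ : Ctx} {p : ℕ} {φ : Tm} :
      Derives Γ .valid → Γ.HasPrf p φ → Derives Γ (.prf (.var p) φ)
  | varE {Γ : Ctx} {e : ℕ} {M : Tm} {A : Ty} {N : Tm} :
      Derives Γ .valid → Γ.HasPth e M A N → Derives Γ (.pth (.var e) M A N)
  | bot {Γ : Ctx} : Derives Γ .valid → Derives Γ (.tm .bot .Omega)
  | imp {Γ : Ctx} {φ ψ : Tm} :
      Derives Γ (.tm φ .Omega) → Derives Γ (.tm ψ .Omega) →
      Derives Γ (.tm (.imp φ ψ) .Omega)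
  | appT {Γ : Ctx} {M N : Tm} {A B : Ty} :
      Derives Γ (.tm M (.arrow A B)) → Derives Γ (.tm N A) → Derives Γ (.tm (.app M N) B)
  | lamT {Γ : Ctx} {M : Tm} {A B : Ty} :
      Derives (.tm Γ A) (.tm M B) → Derives Γ (.tm (.lam A M) (.arrow A B))
  | appP {Γ : Ctx} {δ ε : Prf} {φ ψ : Tm} :
      Derives Γ (.prf δ (.imp φ ψ)) → Derives Γ (.prf ε φ) → Derives Γ (.prf (.app δ ε) ψ)
  | lamP {Γ : Ctx} {δ : Prf} {φ ψ : Tm} :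
      Derives (.prf Γ φ) (.prf δ ψ) → Derives Γ (.prf (.lam φ δ) (.imp φ ψ))
  | convP {Γ : Ctx} {δ : Prf} {φ ψ : Tm} :
      Derives Γ (.prf δ φ) → Derives Γ (.tm ψ .Omega) → Tm.Conv φ ψ → Derives Γ (.prf δ ψ)
  | ref {Γ : Ctx} {M : Tm} {A : Ty} :
      Derives Γ (.tm M A) → Derives Γ (.pth (.ref M) M A M)
  | impE {Γ : Ctx} {P Q : Pth} {φ φ' ψ ψ' : Tm} :
      Derives Γ (.pth P φ .Omega φ') → Derives Γ (.pth Q ψ .Omega ψ') →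
      Derives Γ (.pth (.imp P Q) (.imp φ ψ) .Omega (.imp φ' ψ'))
  | univ {Γ : Ctx} {δ ε : Prf} {φ ψ : Tm} :
      Derives Γ (.prf δ (.imp φ ψ)) → Derives Γ (.prf ε (.imp ψ φ)) →
      Derives Γ (.pth (.univ φ ψ δ ε) φ .Omega ψ)
  | plus {Γ : Ctx} {P : Pth} {φ ψ : Tm} :
      Derives Γ (.pth P φ .Omega ψ) → Derives Γ (.prf (.plus P) (.imp φ ψ))
  | minus {Γ : Ctx} {P : Pth} {φ ψ : Tm} :
      Derives Γ (.pth P φ .Omega ψ) → Derives Γ (.prf (.minus P) (.imp ψ φ))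
  /-- From `Γ, x : A, y : A, e : x =_A y ⊢ P : M x =_B N y` and `Γ ⊢ M, N : A → B`. -/
  | lll {Γ : Ctx} {P : Pth} {M N : Tm} {A B : Ty} :
      Derives (.pth (.tm (.tm Γ A) A) (.var 1) A (.var 0))
        (.pth P (.app M.wk.wk (.var 1)) B (.app N.wk.wk (.var 0))) →
      Derives Γ (.tm M (.arrow A B)) → Derives Γ (.tm N (.arrow A B)) →
      Derives Γ (.pth (.lll A P) M (.arrow A B) N)
  | appE {Γ : Ctx} {P Q : Pth} {M M' N N' : Tm} {A B : Ty} :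
      Derives Γ (.pth P M (.arrow A B) M') → Derives Γ (.pth Q N A N') →
      Derives Γ (.tm N A) → Derives Γ (.tm N' A) →
      Derives Γ (.pth (.app P N N' Q) (.app M N) B (.app M' N'))
  | convE {Γ : Ctx} {P : Pth} {M M' N N' : Tm} {A : Ty} :
      Derives Γ (.pth P M A N) → Derives Γ (.tm M' A) → Derives Γ (.tm N' A) →
      Tm.Conv M M' → Tm.Conv N N' → Derives Γ (.pth P M' A N')

/-- No term variable is declared in the context. -/
def Ctx.NoTmVar : Ctx → Prop
  | .nil => True
  | .tm _ _ => False
  | .prf Γ _ => Γ.NoTmVar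
  | .pth Γ _ _ _ => Γ.NoTmVar

/-! ### Canonical and neutral proofs and paths -/

/-- Canonical proofs: `λ p:φ. δ`. -/
inductive Prf.Canonical : Prf → Prop
  | lam (φ : Tm) (δ : Prf) : Prf.Canonical (.lam φ δ)

/-- Canonical paths: `ref M`, `univ φ ψ δ ε` and `λλλ e : x =_A y. P`. -/
inductive Pth.Canonical : Pth → Prop
  | ref (M : Tm) : Pth.Canonical (.ref M)
  | univ (φ ψ : Tm) (δ ε : Prf) : Pth.Canonical (.univ φ ψ δ ε)
  | lll (A : Ty) (P : Pth) : Pth.Canonical (.lll A P)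

/-- Neutral paths. -/
inductive Pth.Neutral : Pth → Prop
  | var (e : ℕ) : Pth.Neutral (.var e)
  | impL {P : Pth} (Q : Pth) : Pth.Neutral P → Pth.Neutral (.imp P Q)
  | impR (Q : Pth) {P : Pth} : Pth.Neutral P → Pth.Neutral (.imp Q P)
  | app {P : Pth} (M N : Tm) (Q : Pth) : Pth.Neutral P → Pth.Neutral (.app P M N Q)

/-- Neutral proofs. -/
inductive Prf.Neutral : Prf → Prop
  | var (p : ℕ) : Prf.Neutral (.var p)
  | plus {P : Pth} : Pth.Neutral P → Prf.Neutral (.plus P)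
  | minus {P : Pth} : Pth.Neutral P → Prf.Neutral (.minus P)
  | app {δ : Prf} (ε : Prf) : Prf.Neutral δ → Prf.Neutral (.app δ ε)

end PHOML

/-!
The proof is by computability (logical relations), for raw expressions: no computable set asks its
members to be typed, so subject reduction plays no role.

Without term variables a proposition is a closed term, and its normal form is built from `⊥` and
`⊃` alone (`Shape`).  Term reduction has the diamond property, so this normal form is unique and
invariant under conversion (`Tm.Conv.hasShape_iff`), and the computable proofs of a proposition can
be defined by recursion on it (`Shape.Comp`).  Computable terms of a type and computable paths
between two terms are defined together by recursion on the type (`Ty.sem`): a computable path of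
type `Ω` reduces to a neutral path, to some `ref χ` where the endpoints have the same normal form,
or to some `univ φ ψ δ ε` with `δ` and `ε` computable; a path of arrow type is computable if it
reduces to a neutral or canonical path and sends computable paths to computable paths.

All these sets are closed under expansion; they contain the neutral proofs, and the neutral paths
between computable terms.  The fundamental theorem `Derives.sound` says that derivable judgements
hold under computable substitutions; for terms it says moreover that path substitution along
computable paths gives a computable path, by which `ref (λx:A.M)` and `(λx:A.M){τ : ρ = σ}` are
computable (`Ctx.ValidTm.lam`).  In a context without term variables the identity substitution is
computable (`Ctx.Valid.compSub_ident`), hence so is every derivable proof or path, and computable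
expressions reduce to neutral or canonical ones.
-/

namespace PHOML

/-! ### Substitution calculus for terms -/

/-- The family sending `0` to `a` and `n + 1` to `f n`. -/
def cons {α : Type} (a : α) (f : ℕ → α) : ℕ → α
  | 0 => a
  | n + 1 => f n

theorem up_up (ξ ζ : ℕ → ℕ) : (fun x => up ζ (up ξ x)) = up (fun x => ζ (ξ x)) := by
  funext x; cases x <;> rfl

theorem up_id : up (fun x => x) = fun x => x := by
  funext x; cases x <;> rfl

theorem Tm.rename_rename (M : Tm) (ξ ζ : ℕ → ℕ) :
    (M.rename ξ).rename ζ = M.rename (fun x => ζ (ξ x)) := by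
  induction M generalizing ξ ζ with
  | lam A M ih => simp only [Tm.rename, ih, up_up]
  | _ => simp_all [Tm.rename]

theorem Tm.rename_id (M : Tm) : M.rename (fun x => x) = M := by
  induction M with
  | lam A M ih => simp only [Tm.rename, up_id, ih]
  | _ => simp_all [Tm.rename]

theorem Tm.rename_subst (M : Tm) (ξ : ℕ → ℕ) (s : ℕ → Tm) :
    (M.rename ξ).subst s = M.subst (fun x => s (ξ x)) := by
  induction M generalizing ξ s with
  | lam A M ih =>
    have h : (fun x => Tm.upSub s (up ξ x)) = Tm.upSub (fun x => s (ξ x)) := by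
      funext x; cases x <;> rfl
    simp only [Tm.rename, Tm.subst, ih, h]
  | _ => simp_all [Tm.rename, Tm.subst]

theorem Tm.upSub_rename (s : ℕ → Tm) (ξ : ℕ → ℕ) :
    (fun x => (Tm.upSub s x).rename (up ξ)) = Tm.upSub (fun x => (s x).rename ξ) := by
  funext x
  cases x with
  | zero => rfl
  | succ n => simp only [Tm.upSub, Tm.rename_rename]; rfl

theorem Tm.subst_rename (M : Tm) (s : ℕ → Tm) (ξ : ℕ → ℕ) :
    (M.subst s).rename ξ = M.subst (fun x => (s x).rename ξ) := by
  induction M generalizing ξ s with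
  | lam A M ih => simp only [Tm.rename, Tm.subst, ih, Tm.upSub_rename]
  | _ => simp_all [Tm.rename, Tm.subst]

theorem Tm.upSub_subst (s t : ℕ → Tm) :
    (fun x => (Tm.upSub s x).subst (Tm.upSub t)) = Tm.upSub (fun x => (s x).subst t) := by
  funext x
  cases x with
  | zero => rfl
  | succ n => simp only [Tm.upSub, Tm.rename_subst, Tm.subst_rename]

theorem Tm.subst_subst (M : Tm) (s t : ℕ → Tm) :
    (M.subst s).subst t = M.subst (fun x => (s x).subst t) := by
  induction M generalizing s t with
  | lam A M ih => simp only [Tm.subst, ih, Tm.upSub_subst]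
  | _ => simp_all [Tm.subst]

theorem Tm.upSub_var : Tm.upSub Tm.var = Tm.var := by
  funext x; cases x <;> rfl

theorem Tm.subst_var (M : Tm) : M.subst Tm.var = M := by
  induction M with
  | lam A M ih => simp only [Tm.subst, Tm.upSub_var, ih]
  | _ => simp_all [Tm.subst]

theorem Tm.single_eq_cons (N : Tm) : Tm.single N = cons N Tm.var := by
  funext x; cases x <;> rfl

theorem Tm.upSub_cons (s t : ℕ → Tm) (N : Tm) :
    (fun x => (Tm.upSub s x).subst (cons N t)) = cons N (fun x => (s x).subst t) := by
  funext x
  cases x with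
  | zero => rfl
  | succ n => simp only [Tm.upSub, Tm.rename_subst]; rfl

theorem Tm.upSub_inst (M N : Tm) (s : ℕ → Tm) :
    (M.subst (Tm.upSub s)).inst N = M.subst (cons N s) := by
  simp only [Tm.inst, Tm.single_eq_cons, Tm.subst_subst, Tm.upSub_cons, Tm.subst_var]

theorem Tm.wk_subst_cons (M N : Tm) (s : ℕ → Tm) : M.wk.subst (cons N s) = M.subst s := by
  simp only [Tm.wk, Tm.rename_subst]; rfl

/-! ### Substitution calculus for proofs and paths -/

mutual
theorem Prf.rename_rename (a b c a' b' c' : ℕ → ℕ) : (δ : Prf) →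
    (δ.rename a b c).rename a' b' c' =
      δ.rename (fun x => a' (a x)) (fun x => b' (b x)) (fun x => c' (c x))
  | .var p => rfl
  | .lam φ δ => by simp only [Prf.rename, Tm.rename_rename, Prf.rename_rename, up_up]
  | .app δ ε => by simp only [Prf.rename, Prf.rename_rename]
  | .plus P => by simp only [Prf.rename, Pth.rename_rename]
  | .minus P => by simp only [Prf.rename, Pth.rename_rename]
theorem Pth.rename_rename (a b c a' b' c' : ℕ → ℕ) : (P : Pth) →
    (P.rename a b c).rename a' b' c' =
      P.rename (fun x => a' (a x)) (fun x => b' (b x)) (fun x => c' (c x))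
  | .var e => rfl
  | .ref M => by simp only [Pth.rename, Tm.rename_rename]
  | .imp P Q => by simp only [Pth.rename, Pth.rename_rename]
  | .univ φ ψ δ ε => by simp only [Pth.rename, Tm.rename_rename, Prf.rename_rename]
  | .lll A P => by simp only [Pth.rename, Pth.rename_rename, up_up]
  | .app P M N Q => by simp only [Pth.rename, Tm.rename_rename, Pth.rename_rename]
end

/-- The substitution `σ` preceded by the renaming `a, b, c`. -/
def Sub.preRename (a b c : ℕ → ℕ) (σ : Sub) : Sub where
  tm := fun x => σ.tm (a x)
  prf := fun x => σ.prf (b x)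
  pth := fun x => σ.pth (c x)

/-- The substitution `σ` followed by the renaming `a, b, c`. -/
def Sub.postRename (σ : Sub) (a b c : ℕ → ℕ) : Sub where
  tm := fun x => (σ.tm x).rename a
  prf := fun x => (σ.prf x).rename a b c
  pth := fun x => (σ.pth x).rename a b c

/-- The substitution `σ` followed by the substitution `τ`. -/
def Sub.comp (σ τ : Sub) : Sub where
  tm := fun x => (σ.tm x).subst τ.tm
  prf := fun x => (σ.prf x).subst τ
  pth := fun x => (σ.pth x).subst τ

/-- The identity substitution. -/
def Sub.ident : Sub := ⟨.var, .var, .var⟩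

theorem Sub.ext_of {σ τ : Sub} (h₁ : ∀ x, σ.tm x = τ.tm x) (h₂ : ∀ x, σ.prf x = τ.prf x)
    (h₃ : ∀ x, σ.pth x = τ.pth x) : σ = τ := by
  cases σ; cases τ
  simp only [Sub.mk.injEq]
  exact ⟨funext h₁, funext h₂, funext h₃⟩

theorem Sub.preRename_upPrf (a b c : ℕ → ℕ) (σ : Sub) :
    σ.upPrf.preRename a (up b) c = (σ.preRename a b c).upPrf :=
  Sub.ext_of (fun _ => rfl) (fun x => by cases x <;> rfl) (fun _ => rfl)

theorem Sub.preRename_upLll (a b c : ℕ → ℕ) (σ : Sub) :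
    σ.upLll.preRename (up (up a)) b (up c) = (σ.preRename a b c).upLll :=
  Sub.ext_of (fun x => by rcases x with _ | _ | x <;> rfl) (fun _ => rfl)
    (fun x => by cases x <;> rfl)

mutual
theorem Prf.rename_subst (a b c : ℕ → ℕ) (σ : Sub) : (δ : Prf) →
    (δ.rename a b c).subst σ = δ.subst (σ.preRename a b c)
  | .var p => rfl
  | .lam φ δ => by
    simp only [Prf.rename, Prf.subst, Tm.rename_subst, Prf.rename_subst, Sub.preRename_upPrf]
    rfl
  | .app δ ε => by simp only [Prf.rename, Prf.subst, Prf.rename_subst]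
  | .plus P => by simp only [Prf.rename, Prf.subst, Pth.rename_subst]
  | .minus P => by simp only [Prf.rename, Prf.subst, Pth.rename_subst]
theorem Pth.rename_subst (a b c : ℕ → ℕ) (σ : Sub) : (P : Pth) →
    (P.rename a b c).subst σ = P.subst (σ.preRename a b c)
  | .var e => rfl
  | .ref M => by simp only [Pth.rename, Pth.subst, Tm.rename_subst]; rfl
  | .imp P Q => by simp only [Pth.rename, Pth.subst, Pth.rename_subst]
  | .univ φ ψ δ ε => by
    simp only [Pth.rename, Pth.subst, Tm.rename_subst, Prf.rename_subst]; rfl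
  | .lll A P => by simp only [Pth.rename, Pth.subst, Pth.rename_subst, Sub.preRename_upLll]
  | .app P M N Q => by
    simp only [Pth.rename, Pth.subst, Tm.rename_subst, Pth.rename_subst]; rfl
end

theorem Sub.postRename_upPrf (a b c : ℕ → ℕ) (σ : Sub) :
    σ.upPrf.postRename a (up b) c = (σ.postRename a b c).upPrf :=
  Sub.ext_of (fun _ => rfl)
    (fun x => by
      cases x with
      | zero => rfl
      | succ n => simp only [Sub.upPrf, Sub.postRename, Prf.rename_rename]; rfl)
    (fun x => by simp only [Sub.upPrf, Sub.postRename, Pth.rename_rename]; rfl)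

theorem Sub.postRename_upLll (a b c : ℕ → ℕ) (σ : Sub) :
    σ.upLll.postRename (up (up a)) b (up c) = (σ.postRename a b c).upLll :=
  Sub.ext_of
    (fun x => by
      simp only [Sub.upLll, Sub.postRename]
      rw [← Tm.upSub_rename, ← Tm.upSub_rename])
    (fun x => by simp only [Sub.upLll, Sub.postRename, Prf.rename_rename]; rfl)
    (fun x => by
      cases x with
      | zero => rfl
      | succ n => simp only [Sub.upLll, Sub.postRename, Pth.rename_rename]; rfl)

mutual
theorem Prf.subst_rename (a b c : ℕ → ℕ) (σ : Sub) : (δ : Prf) →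
    (δ.subst σ).rename a b c = δ.subst (σ.postRename a b c)
  | .var p => rfl
  | .lam φ δ => by
    simp only [Prf.rename, Prf.subst, Tm.subst_rename, Prf.subst_rename, Sub.postRename_upPrf]
    rfl
  | .app δ ε => by simp only [Prf.rename, Prf.subst, Prf.subst_rename]
  | .plus P => by simp only [Prf.rename, Prf.subst, Pth.subst_rename]
  | .minus P => by simp only [Prf.rename, Prf.subst, Pth.subst_rename]
theorem Pth.subst_rename (a b c : ℕ → ℕ) (σ : Sub) : (P : Pth) →
    (P.subst σ).rename a b c = P.subst (σ.postRename a b c)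
  | .var e => rfl
  | .ref M => by simp only [Pth.rename, Pth.subst, Tm.subst_rename]; rfl
  | .imp P Q => by simp only [Pth.rename, Pth.subst, Pth.subst_rename]
  | .univ φ ψ δ ε => by
    simp only [Pth.rename, Pth.subst, Tm.subst_rename, Prf.subst_rename]; rfl
  | .lll A P => by simp only [Pth.rename, Pth.subst, Pth.subst_rename, Sub.postRename_upLll]
  | .app P M N Q => by
    simp only [Pth.rename, Pth.subst, Tm.subst_rename, Pth.subst_rename]; rfl
end

theorem Sub.upPrf_preRename_succ (σ : Sub) :
    σ.upPrf.preRename id (· + 1) id = σ.postRename id (· + 1) id :=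
  Sub.ext_of (fun x => (Tm.rename_id (σ.tm x)).symm) (fun _ => rfl) (fun _ => rfl)

theorem Sub.upLll_preRename_succ (σ : Sub) :
    σ.upLll.preRename (· + 2) id (· + 1) = σ.postRename (· + 2) id (· + 1) :=
  Sub.ext_of (fun x => Tm.rename_rename (σ.tm x) _ _) (fun _ => rfl) (fun _ => rfl)

theorem Sub.upPrf_comp (σ τ : Sub) : σ.upPrf.comp τ.upPrf = (σ.comp τ).upPrf :=
  Sub.ext_of (fun _ => rfl)
    (fun x => by
      cases x with
      | zero => rfl
      | succ n =>
        simp only [Sub.comp]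
        simp only [Sub.upPrf]
        rw [← Sub.upPrf, Prf.rename_subst, Prf.subst_rename, Sub.upPrf_preRename_succ])
    (fun x => by
      change ((σ.pth x).rename id (· + 1) id).subst τ.upPrf =
        ((σ.pth x).subst τ).rename id (· + 1) id
      rw [Pth.rename_subst, Pth.subst_rename, Sub.upPrf_preRename_succ])

theorem Sub.upLll_comp (σ τ : Sub) : σ.upLll.comp τ.upLll = (σ.comp τ).upLll :=
  Sub.ext_of
    (fun x => by
      simp only [Sub.upLll, Sub.comp]
      rw [← Tm.upSub_subst, ← Tm.upSub_subst])
    (fun x => by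
      change ((σ.prf x).rename (· + 2) id (· + 1)).subst τ.upLll =
        ((σ.prf x).subst τ).rename (· + 2) id (· + 1)
      rw [Prf.rename_subst, Prf.subst_rename, Sub.upLll_preRename_succ])
    (fun x => by
      cases x with
      | zero => rfl
      | succ n =>
        change ((σ.pth n).rename (· + 2) id (· + 1)).subst τ.upLll =
          ((σ.pth n).subst τ).rename (· + 2) id (· + 1)
        rw [Pth.rename_subst, Pth.subst_rename, Sub.upLll_preRename_succ])

mutual
theorem Prf.subst_subst (σ τ : Sub) : (δ : Prf) →
    (δ.subst σ).subst τ = δ.subst (σ.comp τ)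
  | .var p => rfl
  | .lam φ δ => by
    simp only [Prf.subst, Tm.subst_subst, Prf.subst_subst, Sub.upPrf_comp]; rfl
  | .app δ ε => by simp only [Prf.subst, Prf.subst_subst]
  | .plus P => by simp only [Prf.subst, Pth.subst_subst]
  | .minus P => by simp only [Prf.subst, Pth.subst_subst]
theorem Pth.subst_subst (σ τ : Sub) : (P : Pth) →
    (P.subst σ).subst τ = P.subst (σ.comp τ)
  | .var e => rfl
  | .ref M => by simp only [Pth.subst, Tm.subst_subst]; rfl
  | .imp P Q => by simp only [Pth.subst, Pth.subst_subst]
  | .univ φ ψ δ ε => by simp only [Pth.subst, Tm.subst_subst, Prf.subst_subst]; rfl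
  | .lll A P => by simp only [Pth.subst, Pth.subst_subst, Sub.upLll_comp]
  | .app P M N Q => by simp only [Pth.subst, Tm.subst_subst, Pth.subst_subst]; rfl
end

theorem Sub.ident_upPrf : Sub.ident.upPrf = Sub.ident :=
  Sub.ext_of (fun _ => rfl) (fun x => by cases x <;> rfl) (fun _ => rfl)

theorem Sub.ident_upLll : Sub.ident.upLll = Sub.ident :=
  Sub.ext_of (fun x => by rcases x with _ | _ | x <;> rfl) (fun _ => rfl)
    (fun x => by cases x <;> rfl)

mutual
theorem Prf.subst_ident : (δ : Prf) → δ.subst Sub.ident = δ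
  | .var p => rfl
  | .lam φ δ => by
    rw [Prf.subst, Sub.ident_upPrf, Prf.subst_ident]; simp only [Sub.ident, Tm.subst_var]
  | .app δ ε => by simp only [Prf.subst, Prf.subst_ident]
  | .plus P => by simp only [Prf.subst, Pth.subst_ident]
  | .minus P => by simp only [Prf.subst, Pth.subst_ident]
theorem Pth.subst_ident : (P : Pth) → P.subst Sub.ident = P
  | .var e => rfl
  | .ref M => by simp only [Pth.subst, Sub.ident, Tm.subst_var]
  | .imp P Q => by simp only [Pth.subst, Pth.subst_ident]
  | .univ φ ψ δ ε => by
    rw [Pth.subst, Prf.subst_ident, Prf.subst_ident]; simp only [Sub.ident, Tm.subst_var]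
  | .lll A P => by rw [Pth.subst, Sub.ident_upLll, Pth.subst_ident]
  | .app P M N Q => by
    rw [Pth.subst, Pth.subst_ident, Pth.subst_ident]; simp only [Sub.ident, Tm.subst_var]
end

/-- The substitution `σ` extended by `ε` at proof variable `0`. -/
def Sub.consPrf (ε : Prf) (σ : Sub) : Sub where
  tm := σ.tm
  prf := cons ε σ.prf
  pth := σ.pth

/-- The substitution `σ` extended by `M`, `N` and `Q` at the variables bound by `λλλ`. -/
def Sub.consLll (M N : Tm) (Q : Pth) (σ : Sub) : Sub where
  tm := cons N (cons M σ.tm)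
  prf := σ.prf
  pth := cons Q σ.pth

theorem Prf.upPrf_singlePrf (δ ε : Prf) (σ : Sub) :
    (δ.subst σ.upPrf).subst (Sub.singlePrf ε) = δ.subst (σ.consPrf ε) := by
  rw [Prf.subst_subst]
  congr 1
  refine Sub.ext_of (fun x => Tm.subst_var _) (fun x => ?_) (fun x => ?_)
  · cases x with
    | zero => rfl
    | succ n => exact (Prf.rename_subst _ _ _ _ _).trans (Prf.subst_ident _)
  · exact (Pth.rename_subst _ _ _ _ _).trans (Pth.subst_ident _)

theorem Pth.upLll_triple (P : Pth) (M N : Tm) (Q : Pth) (σ : Sub) :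
    (P.subst σ.upLll).subst (Sub.triple M N Q) = P.subst (σ.consLll M N Q) := by
  rw [Pth.subst_subst]
  congr 1
  refine Sub.ext_of (fun x => ?_) (fun x => ?_) (fun x => ?_)
  · rcases x with _ | _ | x
    · rfl
    · rfl
    · change (((σ.tm x).rename (· + 1)).rename (· + 1)).subst _ = σ.tm x
      rw [Tm.rename_rename, Tm.rename_subst]
      exact Tm.subst_var _
  · exact (Prf.rename_subst _ _ _ _ _).trans (Prf.subst_ident _)
  · cases x with
    | zero => rfl
    | succ n => exact (Pth.rename_subst _ _ _ _ _).trans (Pth.subst_ident _)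

/-! ### Path substitution -/

theorem Tm.rename_pathSubst (M : Tm) (ξ : ℕ → ℕ) (τ : ℕ → Pth) (ρ σ : ℕ → Tm) :
    (M.rename ξ).pathSubst τ ρ σ =
      M.pathSubst (fun x => τ (ξ x)) (fun x => ρ (ξ x)) (fun x => σ (ξ x)) := by
  induction M generalizing ξ τ ρ σ with
  | lam A M ih =>
    simp only [Tm.rename, Tm.pathSubst, ih]
    congr 2 <;> (funext x; cases x <;> rfl)
  | _ => simp_all [Tm.rename, Tm.pathSubst, Tm.rename_subst]

theorem Tm.pathSubst_rename (M : Tm) (τ : ℕ → Pth) (ρ σ : ℕ → Tm) (a b c : ℕ → ℕ) :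
    (M.pathSubst τ ρ σ).rename a b c =
      M.pathSubst (fun x => (τ x).rename a b c) (fun x => (ρ x).rename a)
        (fun x => (σ x).rename a) := by
  induction M generalizing τ ρ σ a b c with
  | lam A M ih =>
    simp only [Tm.pathSubst, Pth.rename, ih]
    congr 2 <;> funext x <;> cases x <;>
      simp only [upPath, upLeft, upRight, Pth.rename_rename, Tm.rename_rename] <;> rfl
  | _ => simp_all [Tm.pathSubst, Pth.rename, Tm.subst_rename, Tm.rename]

theorem Tm.rename_upLll (M : Tm) (s : Sub) :
    (M.rename (· + 2)).subst s.upLll.tm = (M.subst s.tm).rename (· + 2) := by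
  rw [Tm.rename_subst, Tm.subst_rename]
  congr 1
  funext x
  exact Tm.rename_rename _ _ _

theorem Tm.pathSubst_subst (M : Tm) (τ : ℕ → Pth) (ρ σ : ℕ → Tm) (s : Sub) :
    (M.pathSubst τ ρ σ).subst s =
      M.pathSubst (fun x => (τ x).subst s) (fun x => (ρ x).subst s.tm)
        (fun x => (σ x).subst s.tm) := by
  induction M generalizing τ ρ σ s with
  | lam A M ih =>
    simp only [Tm.pathSubst, Pth.subst]
    rw [ih]
    congr 2 <;> funext x <;> cases x with
    | zero => rfl
    | succ n =>
      first
      | exact Tm.rename_upLll _ _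
      | (simp only [upPath]
         rw [Pth.rename_subst, Pth.subst_rename, Sub.upLll_preRename_succ])
  | _ => simp_all [Tm.pathSubst, Pth.subst, Tm.subst_subst, Tm.subst]

theorem Tm.subst_pathSubst (M : Tm) (s : ℕ → Tm) (τ : ℕ → Pth) (ρ σ : ℕ → Tm) :
    (M.subst s).pathSubst τ ρ σ =
      M.pathSubst (fun x => (s x).pathSubst τ ρ σ) (fun x => (s x).subst ρ)
        (fun x => (s x).subst σ) := by
  induction M generalizing s τ ρ σ with
  | lam A M ih =>
    simp only [Tm.pathSubst, Tm.subst, ih]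
    congr 2 <;> funext x <;> cases x <;>
      simp only [upPath, upLeft, upRight, Tm.upSub, Tm.rename_pathSubst, Tm.pathSubst_rename,
        Tm.rename_subst, Tm.subst_rename] <;> rfl
  | _ => simp_all [Tm.pathSubst, Tm.subst, Tm.subst_subst]

/-- The path `M {}`, the path substitution of `ref x` for every variable `x`. -/
def Tm.reflPath (M : Tm) : Pth := M.pathSubst (fun x => .ref (.var x)) .var .var

theorem Pth.single_eq_cons (P : Pth) : Pth.single P = cons P (fun x => .ref (.var x)) := by
  funext x; cases x <;> rfl

theorem Tm.subst_reflPath (M : Tm) (s : ℕ → Tm) :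
    (M.subst s).reflPath = M.pathSubst (fun x => (s x).reflPath) s s := by
  simp only [Tm.reflPath, Tm.subst_pathSubst, Tm.subst_var]

theorem Tm.upSub_pathInst (M : Tm) (s : ℕ → Tm) (Q : Pth) (N N' : Tm) :
    (M.subst (Tm.upSub s)).pathInst Q N N' =
      M.pathSubst (cons Q (fun x => (s x).reflPath)) (cons N s) (cons N' s) := by
  simp only [Tm.pathInst, Tm.subst_pathSubst, Pth.single_eq_cons, Tm.single_eq_cons,
    Tm.upSub_cons, Tm.subst_var]
  congr 1
  funext x
  cases x with
  | zero => rfl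
  | succ n => simp only [Tm.upSub, Tm.rename_pathSubst]; rfl

/-- The contractum of `(λx:A.M){τ : ρ = σ}` applied at `N`, `N'` to `Q`. -/
theorem Tm.pathSubst_triple (M : Tm) (τ : ℕ → Pth) (ρ σ : ℕ → Tm) (N N' : Tm) (Q : Pth) :
    (M.pathSubst (upPath τ) (upLeft ρ) (upRight σ)).subst (Sub.triple N N' Q) =
      M.pathSubst (cons Q τ) (cons N ρ) (cons N' σ) := by
  rw [Tm.pathSubst_subst]
  congr 1 <;> funext x <;> cases x with
  | zero => rfl
  | succ n =>
    first
    | exact (Tm.rename_subst _ _ _).trans (Tm.subst_var _)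
    | exact (Pth.rename_subst _ _ _ _ _).trans (Pth.subst_ident _)

/-! ### Reduction of terms -/

theorem Tm.Red.subst {M M' : Tm} (h : Tm.Red M M') (s : ℕ → Tm) :
    Tm.Red (M.subst s) (M'.subst s) := by
  induction h with
  | beta A M N =>
    have e : (M.inst N).subst s = (M.subst (Tm.upSub s)).inst (N.subst s) := by
      rw [Tm.upSub_inst, Tm.inst, Tm.subst_subst]
      congr 1
      funext x; cases x <;> rfl
    rw [e]
    exact .beta _ _ _
  | app N _ ih => exact .app _ ih
  | impL ψ _ ih => exact .impL _ ih
  | impR φ _ ih => exact .impR _ ih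

/-- A reduction step is matched by exactly one step between the path substitution instances. -/
theorem Tm.Red.pathSubst {M M' : Tm} (h : Tm.Red M M') (τ : ℕ → Pth) (ρ σ : ℕ → Tm) :
    Pth.Red (M.pathSubst τ ρ σ) (M'.pathSubst τ ρ σ) := by
  induction h with
  | beta A M N =>
    have e : (M.inst N).pathSubst τ ρ σ =
        (M.pathSubst (upPath τ) (upLeft ρ) (upRight σ)).subst
          (Sub.triple (N.subst ρ) (N.subst σ) (N.pathSubst τ ρ σ)) := by
      rw [Tm.pathSubst_triple, Tm.inst, Tm.subst_pathSubst]
      congr 1 <;> (funext x; cases x <;> rfl)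
    rw [e]
    exact .beta _ _ _ _ _
  | app N _ ih => exact .app _ _ _ ih
  | impL ψ _ ih => exact .impL _ ih
  | impR φ _ ih => exact .impR _ ih

theorem Tm.Conv.subst {M M' : Tm} (h : Tm.Conv M M') (s : ℕ → Tm) :
    Tm.Conv (M.subst s) (M'.subst s) := by
  induction h with
  | rel _ _ h => exact .rel _ _ (h.subst s)
  | refl _ => exact .refl _
  | symm _ _ _ ih => exact .symm _ _ ih
  | trans _ _ _ _ _ ih₁ ih₂ => exact .trans _ _ _ ih₁ ih₂

theorem Tm.Conv.app {M M' : Tm} (h : Tm.Conv M M') (N : Tm) :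
    Tm.Conv (.app M N) (.app M' N) := by
  induction h with
  | rel _ _ h => exact .rel _ _ (h.app N)
  | refl _ => exact .refl _
  | symm _ _ _ ih => exact .symm _ _ ih
  | trans _ _ _ _ _ ih₁ ih₂ => exact .trans _ _ _ ih₁ ih₂

theorem Tm.Red.diamond {M M₁ M₂ : Tm} (h₁ : Tm.Red M M₁) (h₂ : Tm.Red M M₂) :
    M₁ = M₂ ∨ ∃ M₃, Tm.Red M₁ M₃ ∧ Tm.Red M₂ M₃ := by
  induction h₁ generalizing M₂ with
  | beta A M N =>
    cases h₂ with
    | beta => exact .inl rfl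
    | app _ h => cases h
  | app N h ih =>
    cases h₂ with
    | beta => cases h
    | app _ h' =>
      obtain rfl | ⟨K, k₁, k₂⟩ := ih h'
      · exact .inl rfl
      · exact .inr ⟨_, .app _ k₁, .app _ k₂⟩
  | impL ψ h ih =>
    cases h₂ with
    | impL _ h' =>
      obtain rfl | ⟨K, k₁, k₂⟩ := ih h'
      · exact .inl rfl
      · exact .inr ⟨_, .impL _ k₁, .impL _ k₂⟩
    | impR _ h' => exact .inr ⟨_, .impR _ h', .impL _ h⟩
  | impR φ h ih =>
    cases h₂ with
    | impR _ h' =>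
      obtain rfl | ⟨K, k₁, k₂⟩ := ih h'
      · exact .inl rfl
      · exact .inr ⟨_, .impR _ k₁, .impR _ k₂⟩
    | impL _ h' => exact .inr ⟨_, .impL _ h', .impR _ h⟩

/-- Reduction of terms in zero or more steps. -/
abbrev Tm.Reds : Tm → Tm → Prop := Relation.ReflTransGen Tm.Red

theorem Tm.Reds.join {M M₁ M₂ : Tm} (h₁ : Tm.Reds M M₁) (h₂ : Tm.Reds M M₂) :
    ∃ K, Tm.Reds M₁ K ∧ Tm.Reds M₂ K := by
  refine Relation.church_rosser (fun a b c hb hc => ?_) h₁ h₂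
  obtain rfl | ⟨d, k₁, k₂⟩ := hb.diamond hc
  · exact ⟨b, .refl, .refl⟩
  · exact ⟨d, .single k₁, .single k₂⟩

theorem Tm.Reds.imp {φ φ' ψ ψ' : Tm} (h₁ : Tm.Reds φ φ') (h₂ : Tm.Reds ψ ψ') :
    Tm.Reds (.imp φ ψ) (.imp φ' ψ') :=
  (h₁.lift (Tm.imp · ψ) fun _ _ h => .impL _ h).trans
    (h₂.lift (Tm.imp φ' ·) fun _ _ h => .impR _ h)

theorem Tm.Reds.imp_inv {φ ψ K : Tm} (h : Tm.Reds (.imp φ ψ) K) :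
    ∃ φ' ψ', K = .imp φ' ψ' ∧ Tm.Reds φ φ' ∧ Tm.Reds ψ ψ' := by
  induction h with
  | refl => exact ⟨φ, ψ, rfl, .refl, .refl⟩
  | tail _ h ih =>
    obtain ⟨φ', ψ', rfl, h₁, h₂⟩ := ih
    cases h with
    | impL _ h => exact ⟨_, _, rfl, h₁.tail h, h₂⟩
    | impR _ h => exact ⟨_, _, rfl, h₁, h₂.tail h⟩

/-- The propositions built from `⊥` and `⊃` alone: the normal forms of the closed terms of
type `Ω`. -/
inductive Shape : Type
  | bot : Shape
  | imp (θ θ' : Shape) : Shape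

/-- A shape as a term. -/
def Shape.toTm : Shape → Tm
  | .bot => .bot
  | .imp θ θ' => .imp θ.toTm θ'.toTm

theorem Shape.toTm_injective : Function.Injective Shape.toTm := by
  intro θ
  induction θ with
  | bot => intro θ'; cases θ' <;> simp [Shape.toTm]
  | imp a b iha ihb =>
    intro θ'
    cases θ' with
    | bot => simp [Shape.toTm]
    | imp c d =>
      intro h
      simp only [Shape.toTm, Tm.imp.injEq] at h
      rw [iha h.1, ihb h.2]

theorem Shape.not_red (θ : Shape) (M : Tm) : ¬ Tm.Red θ.toTm M := by
  induction θ generalizing M with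
  | bot => intro h; cases h
  | imp a b iha ihb =>
    intro h
    cases h with
    | impL _ h => exact iha _ h
    | impR _ h => exact ihb _ h

theorem Shape.reds_eq {θ : Shape} {M : Tm} (h : Tm.Reds θ.toTm M) : M = θ.toTm := by
  induction h with
  | refl => rfl
  | tail _ h ih => subst ih; exact absurd h (θ.not_red _)

/-- `φ.HasShape θ` means that `φ` reduces to the normal form `θ`. -/
def Tm.HasShape (φ : Tm) (θ : Shape) : Prop := Tm.Reds φ θ.toTm

theorem Tm.HasShape.unique {φ : Tm} {θ θ' : Shape} (h : φ.HasShape θ) (h' : φ.HasShape θ') :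
    θ = θ' := by
  obtain ⟨K, k₁, k₂⟩ := Tm.Reds.join h h'
  exact Shape.toTm_injective ((Shape.reds_eq k₁).symm.trans (Shape.reds_eq k₂))

theorem Tm.HasShape.of_red {φ ψ : Tm} {θ : Shape} (h : φ.HasShape θ) (hr : Tm.Red φ ψ) :
    ψ.HasShape θ := by
  obtain ⟨K, k₁, k₂⟩ := Tm.Reds.join h (.single hr)
  rw [Shape.reds_eq k₁] at k₂
  exact k₂

theorem Tm.Conv.hasShape_iff {φ ψ : Tm} (h : Tm.Conv φ ψ) (θ : Shape) :
    φ.HasShape θ ↔ ψ.HasShape θ := by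
  induction h with
  | rel _ _ h => exact ⟨fun k => k.of_red h, fun k => .head h k⟩
  | refl _ => exact Iff.rfl
  | symm _ _ _ ih => exact ih.symm
  | trans _ _ _ _ _ ih₁ ih₂ => exact ih₁.trans ih₂

theorem Tm.HasShape.imp {φ ψ : Tm} {θ θ' : Shape} (h : φ.HasShape θ) (h' : ψ.HasShape θ') :
    (Tm.imp φ ψ).HasShape (.imp θ θ') :=
  Tm.Reds.imp h h'

theorem Tm.HasShape.imp_inv {φ ψ : Tm} {θ : Shape} (h : (Tm.imp φ ψ).HasShape θ) :
    ∃ θ₁ θ₂, θ = .imp θ₁ θ₂ ∧ φ.HasShape θ₁ ∧ ψ.HasShape θ₂ := by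
  obtain ⟨φ', ψ', e, h₁, h₂⟩ := Tm.Reds.imp_inv h
  cases θ with
  | bot => cases e
  | imp a b =>
    simp only [Shape.toTm, Tm.imp.injEq] at e
    obtain ⟨rfl, rfl⟩ := e
    exact ⟨a, b, rfl, h₁, h₂⟩

/-! ### Computable proofs -/

/-- `δ` reduces to a neutral or canonical proof. -/
def Prf.WN (δ : Prf) : Prop := ∃ δ', δ.Reds δ' ∧ (δ'.Neutral ∨ δ'.Canonical)

/-- `P` reduces to a neutral or canonical path. -/
def Pth.WN (P : Pth) : Prop := ∃ P', P.Reds P' ∧ (P'.Neutral ∨ P'.Canonical)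

/-- The computable proofs of a normal proposition.  No typing is required of them. -/
def Shape.Comp : Shape → Prf → Prop
  | .bot, δ => δ.WN
  | .imp θ θ', δ => δ.WN ∧ ∀ ε, θ.Comp ε → θ'.Comp (.app δ ε)

theorem Shape.Comp.wn {θ : Shape} {δ : Prf} (h : θ.Comp δ) : δ.WN := by
  cases θ with
  | bot => exact h
  | imp => exact h.1

theorem Shape.comp_of_neutral (θ : Shape) {δ : Prf} (h : δ.Neutral) : θ.Comp δ := by
  induction θ generalizing δ with
  | bot => exact ⟨δ, .refl, .inl h⟩
  | imp a b _ ihb => exact ⟨⟨δ, .refl, .inl h⟩, fun ε _ => ihb (.app ε h)⟩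

theorem Prf.Reds.app {δ δ' : Prf} (h : δ.Reds δ') (ε : Prf) :
    Prf.Reds (.app δ ε) (.app δ' ε) :=
  Relation.ReflTransGen.lift (Prf.app · ε) (fun _ _ k => Prf.Red.app ε k) _ _ h

theorem Prf.WN.expand {δ δ' : Prf} (hr : δ.Reds δ') : δ'.WN → δ.WN
  | ⟨K, k, h⟩ => ⟨K, Relation.ReflTransGen.trans hr k, h⟩

theorem Pth.WN.expand {P P' : Pth} (hr : P.Reds P') : P'.WN → P.WN
  | ⟨K, k, h⟩ => ⟨K, Relation.ReflTransGen.trans hr k, h⟩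

theorem Shape.Comp.expand {θ : Shape} {δ δ' : Prf} (h : θ.Comp δ') (hr : δ.Reds δ') :
    θ.Comp δ := by
  induction θ generalizing δ δ' with
  | bot => exact Prf.WN.expand hr h
  | imp a b _ ihb => exact ⟨h.1.expand hr, fun ε hε => ihb (h.2 ε hε) (hr.app ε)⟩

theorem Shape.comp_lam {θ θ' : Shape} {φ : Tm} {δ : Prf}
    (h : ∀ ε, θ.Comp ε → θ'.Comp (δ.subst (Sub.singlePrf ε))) :
    (Shape.imp θ θ').Comp (.lam φ δ) :=
  ⟨⟨_, .refl, .inr (.lam φ δ)⟩, fun ε hε => (h ε hε).expand (.single (.beta φ δ ε))⟩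

theorem Shape.comp_lam_var (θ : Shape) (φ : Tm) : (Shape.imp θ θ).Comp (.lam φ (.var 0)) :=
  Shape.comp_lam fun _ h => h

theorem Prf.wk2_subst (δ ε ε' : Prf) :
    (δ.wk2.subst (Sub.singlePrf ε).upPrf).subst (Sub.singlePrf ε') = δ := by
  rw [Prf.upPrf_singlePrf, Prf.wk2, Prf.rename_subst]
  exact Prf.subst_ident δ

theorem Prf.wk_subst (ε ε' : Prf) :
    (ε.rename id (· + 1) id).subst (Sub.singlePrf ε') = ε := by
  rw [Prf.rename_subst]
  exact Prf.subst_ident ε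

/-- The proof `λp.λq.δ(pq)` of `(θ ⊃ θ₁) ⊃ (θ ⊃ θ₂)`. -/
theorem Shape.comp_postcomp {θ θ₁ θ₂ : Shape} {δ : Prf} (φ ψ : Tm)
    (h : (Shape.imp θ₁ θ₂).Comp δ) :
    (Shape.imp (.imp θ θ₁) (.imp θ θ₂)).Comp
      (.lam φ (.lam ψ (.app δ.wk2 (.app (.var 1) (.var 0))))) := by
  refine Shape.comp_lam fun ε hε => Shape.comp_lam fun ε' hε' => ?_
  simp only [Prf.subst, Prf.wk2_subst]
  simp only [Sub.upPrf, Sub.singlePrf, Prf.subst]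
  rw [← Sub.singlePrf, Prf.wk_subst]
  exact h.2 _ (hε.2 _ hε')

/-- The proof `λp.λq.p(εq)` of `(θ₁ ⊃ θ) ⊃ (θ₂ ⊃ θ)`. -/
theorem Shape.comp_precomp {θ θ₁ θ₂ : Shape} {ε : Prf} (φ ψ : Tm)
    (h : (Shape.imp θ₂ θ₁).Comp ε) :
    (Shape.imp (.imp θ₁ θ) (.imp θ₂ θ)).Comp
      (.lam φ (.lam ψ (.app (.var 1) (.app ε.wk2 (.var 0))))) := by
  refine Shape.comp_lam fun δ hδ => Shape.comp_lam fun ε' hε' => ?_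
  simp only [Prf.subst, Prf.wk2_subst]
  simp only [Sub.upPrf, Sub.singlePrf, Prf.subst]
  rw [← Sub.singlePrf, Prf.wk_subst]
  exact hδ.2 _ (h.2 _ hε')

/-- The proof `λp.λq.δ(p(εq))` of `(θ₁ ⊃ θ₁') ⊃ (θ₂ ⊃ θ₂')`. -/
theorem Shape.comp_conj {θ₁ θ₁' θ₂ θ₂' : Shape} {δ ε : Prf} (φ ψ : Tm)
    (h : (Shape.imp θ₁' θ₂').Comp δ) (h' : (Shape.imp θ₂ θ₁).Comp ε) :
    (Shape.imp (.imp θ₁ θ₁') (.imp θ₂ θ₂')).Comp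
      (.lam φ (.lam ψ (.app δ.wk2 (.app (.var 1) (.app ε.wk2 (.var 0)))))) := by
  refine Shape.comp_lam fun δ' hδ' => Shape.comp_lam fun ε' hε' => ?_
  simp only [Prf.subst, Prf.wk2_subst]
  simp only [Sub.upPrf, Sub.singlePrf, Prf.subst]
  rw [← Sub.singlePrf, Prf.wk_subst]
  exact h.2 _ (hδ'.2 _ (h'.2 _ hε'))

/-- `δ` is a computable proof of the normal form of `φ`. -/
def Prf.CompAt (δ : Prf) (φ : Tm) : Prop := ∃ θ, φ.HasShape θ ∧ θ.Comp δ

/-! ### Computable terms and paths -/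

/-- The computable paths between propositions of shapes `θ` and `θ'`.  The equation `θ = θ'`
in the case of `ref` is what makes `ref χ ⁺` and `ref χ ⁻`, whose contracta are identity
functions, computable; in a typed setting it would follow from subject reduction. -/
inductive Pth.CompOmega (θ θ' : Shape) (P : Pth) : Prop
  | neutral {P' : Pth} : P.Reds P' → P'.Neutral → Pth.CompOmega θ θ' P
  | ref {χ : Tm} : P.Reds (.ref χ) → θ = θ' → Pth.CompOmega θ θ' P
  | univ {φ ψ : Tm} {δ ε : Prf} : P.Reds (.univ φ ψ δ ε) → (Shape.imp θ θ').Comp δ →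
      (Shape.imp θ' θ).Comp ε → Pth.CompOmega θ θ' P

/-- The interpretation of a type: a set of computable terms, and a set of computable paths
between any two terms. -/
structure Sem : Type where
  tm : Tm → Prop
  pth : Pth → Tm → Tm → Prop

/-- Computability of a path `P : M =_{A → B} N`. -/
def Sem.arrowPth (S T : Sem) (P : Pth) (M N : Tm) : Prop :=
  P.WN ∧ ∀ L L' Q, S.tm L → S.tm L' → S.pth Q L L' →
    T.pth (.app P L L' Q) (.app M L) (.app N L')

/-- Computability at `A` of terms and of paths.  A computable function `M` has to preserve
computable paths in two ways, through `ref M` and through the path `M {}`.  The two are different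
paths: `ref (λx:A.L)` applied to a path contracts to a path substitution instance of `L`, and
where `L` is itself an instance `L'[y := M]`, the path that this puts for `y` is `M {}`, not
`ref M`. -/
def Ty.sem : Ty → Sem
  | .Omega =>
    { tm := fun M => ∃ θ, M.HasShape θ
      pth := fun P M N => ∃ θ θ', M.HasShape θ ∧ N.HasShape θ' ∧ P.CompOmega θ θ' }
  | .arrow A B =>
    { tm := fun M => (∀ N, A.sem.tm N → B.sem.tm (.app M N)) ∧
        A.sem.arrowPth B.sem (.ref M) M M ∧ A.sem.arrowPth B.sem M.reflPath M M
      pth := A.sem.arrowPth B.sem }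

theorem Pth.Reds.app {P P' : Pth} (h : P.Reds P') (M N : Tm) (Q : Pth) :
    Pth.Reds (.app P M N Q) (.app P' M N Q) :=
  Relation.ReflTransGen.lift (Pth.app · M N Q) (fun _ _ k => Pth.Red.app M N Q k) _ _ h

theorem Pth.Reds.imp {P P' Q Q' : Pth} (h₁ : P.Reds P') (h₂ : Q.Reds Q') :
    Pth.Reds (.imp P Q) (.imp P' Q') :=
  Relation.ReflTransGen.trans
    (Relation.ReflTransGen.lift (Pth.imp · Q) (fun _ _ k => Pth.Red.impL _ k) _ _ h₁)
    (Relation.ReflTransGen.lift (Pth.imp P' ·) (fun _ _ k => Pth.Red.impR _ k) _ _ h₂)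

theorem Pth.Reds.plus {P P' : Pth} (h : P.Reds P') : Prf.Reds (.plus P) (.plus P') :=
  Relation.ReflTransGen.lift Prf.plus (fun _ _ k => Prf.Red.plus k) _ _ h

theorem Pth.Reds.minus {P P' : Pth} (h : P.Reds P') : Prf.Reds (.minus P) (.minus P') :=
  Relation.ReflTransGen.lift Prf.minus (fun _ _ k => Prf.Red.minus k) _ _ h

theorem Pth.CompOmega.expand {θ θ' : Shape} {P P' : Pth} (hr : P.Reds P')
    (h : P'.CompOmega θ θ') : P.CompOmega θ θ' := by
  cases h with
  | neutral h k => exact .neutral (Relation.ReflTransGen.trans hr h) k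
  | ref h k => exact .ref (Relation.ReflTransGen.trans hr h) k
  | univ h k l => exact .univ (Relation.ReflTransGen.trans hr h) k l

theorem Pth.CompOmega.wn {θ θ' : Shape} {P : Pth} (h : P.CompOmega θ θ') : P.WN := by
  cases h with
  | neutral h k => exact ⟨_, h, .inl k⟩
  | ref h _ => exact ⟨_, h, .inr (.ref _)⟩
  | univ h _ _ => exact ⟨_, h, .inr (.univ _ _ _ _)⟩

theorem Pth.CompOmega.plus {θ θ' : Shape} {P : Pth} (h : P.CompOmega θ θ') :
    (Shape.imp θ θ').Comp (.plus P) := by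
  cases h with
  | neutral h k => exact (Shape.comp_of_neutral _ (.plus k)).expand h.plus
  | ref h e =>
    subst e
    exact (θ.comp_lam_var _).expand (h.plus.tail (.refPlus _))
  | univ h k _ => exact k.expand (h.plus.tail (.univPlus _ _ _ _))

theorem Pth.CompOmega.minus {θ θ' : Shape} {P : Pth} (h : P.CompOmega θ θ') :
    (Shape.imp θ' θ).Comp (.minus P) := by
  cases h with
  | neutral h k => exact (Shape.comp_of_neutral _ (.minus k)).expand h.minus
  | ref h e =>
    subst e
    exact (θ.comp_lam_var _).expand (h.minus.tail (.refMinus _))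
  | univ h _ k => exact k.expand (h.minus.tail (.univMinus _ _ _ _))

theorem Pth.CompOmega.imp {θ₁ θ₁' θ₂ θ₂' : Shape} {P Q : Pth} (h : P.CompOmega θ₁ θ₁')
    (k : Q.CompOmega θ₂ θ₂') :
    (Pth.imp P Q).CompOmega (.imp θ₁ θ₂) (.imp θ₁' θ₂') := by
  cases h with
  | neutral h n => exact .neutral (h.imp .refl) (.impL _ n)
  | ref h e =>
    subst e
    cases k with
    | neutral k n => exact .neutral (h.imp k) (.impR _ n)
    | ref k e =>
      subst e
      exact .ref ((h.imp k).tail (.refRef _ _)) rfl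
    | univ k c d =>
      exact .univ ((h.imp k).tail (.refUniv _ _ _ _ _)) (Shape.comp_postcomp _ _ c)
        (Shape.comp_postcomp _ _ d)
  | univ h a b =>
    cases k with
    | neutral k n => exact .neutral (h.imp k) (.impR _ n)
    | ref k e =>
      subst e
      exact .univ ((h.imp k).tail (.univRef _ _ _ _ _)) (Shape.comp_precomp _ _ b)
        (Shape.comp_precomp _ _ a)
    | univ k c d =>
      exact .univ ((h.imp k).tail (.univUniv _ _ _ _ _ _ _ _)) (Shape.comp_conj _ _ c b)
        (Shape.comp_conj _ _ d a)

theorem Ty.pth_wn {A : Ty} {P : Pth} {M N : Tm} (h : A.sem.pth P M N) : P.WN := by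
  cases A with
  | Omega => obtain ⟨_, _, _, _, h⟩ := h; exact h.wn
  | arrow => exact h.1

theorem Ty.pth_expand {A : Ty} {P P' : Pth} {M N : Tm} (hr : P.Reds P')
    (h : A.sem.pth P' M N) : A.sem.pth P M N := by
  induction A generalizing P P' M N with
  | Omega =>
    obtain ⟨θ, θ', h₁, h₂, h⟩ := h
    exact ⟨θ, θ', h₁, h₂, h.expand hr⟩
  | arrow A B _ ihB =>
    exact ⟨h.1.expand hr, fun L L' Q hL hL' hQ => ihB (hr.app L L' Q) (h.2 L L' Q hL hL' hQ)⟩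

theorem Ty.pth_conv {A : Ty} {P : Pth} {M M' N N' : Tm} (h : A.sem.pth P M N)
    (hM : Tm.Conv M M') (hN : Tm.Conv N N') : A.sem.pth P M' N' := by
  induction A generalizing P M M' N N' with
  | Omega =>
    obtain ⟨θ, θ', h₁, h₂, h⟩ := h
    exact ⟨θ, θ', (hM.hasShape_iff θ).1 h₁, (hN.hasShape_iff θ').1 h₂, h⟩
  | arrow A B _ ihB =>
    exact ⟨h.1, fun L L' Q hL hL' hQ => ihB (h.2 L L' Q hL hL' hQ) (hM.app L) (hN.app L')⟩

theorem Ty.pth_of_neutral {A : Ty} {P : Pth} {M N : Tm} (h : P.Neutral) (hM : A.sem.tm M)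
    (hN : A.sem.tm N) : A.sem.pth P M N := by
  induction A generalizing P M N with
  | Omega =>
    obtain ⟨θ, hθ⟩ := hM
    obtain ⟨θ', hθ'⟩ := hN
    exact ⟨θ, θ', hθ, hθ', .neutral .refl h⟩
  | arrow A B _ ihB =>
    exact ⟨⟨P, .refl, .inl h⟩,
      fun L L' Q hL hL' _ => ihB (.app _ _ _ h) (hM.1 L hL) (hN.1 L' hL')⟩

theorem Ty.tm_expand {A : Ty} {M M' : Tm} (hr : Tm.Red M M') (h : A.sem.tm M') :
    A.sem.tm M := by
  induction A generalizing M M' with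
  | Omega =>
    obtain ⟨θ, h⟩ := h
    exact ⟨θ, .head hr h⟩
  | arrow A B _ ihB =>
    have hc : Tm.Conv M' M := .symm _ _ (.rel _ _ hr)
    refine ⟨fun N hN => ihB (.app N hr) (h.1 N hN), ⟨⟨_, .refl, .inr (.ref M)⟩, ?_⟩, ?_⟩
    · intro L L' Q hL hL' hQ
      exact Ty.pth_expand (.single (.appRef L L' Q hr))
        (Ty.pth_conv (h.2.1.2 L L' Q hL hL' hQ) (hc.app L) (hc.app L'))
    · exact Ty.pth_expand (A := .arrow A B) (.single (hr.pathSubst _ _ _))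
        (Ty.pth_conv (A := .arrow A B) h.2.2 hc hc)

theorem Ty.pth_ref {A : Ty} {M : Tm} (h : A.sem.tm M) : A.sem.pth (.ref M) M M := by
  cases A with
  | Omega =>
    obtain ⟨θ, h⟩ := h
    exact ⟨θ, θ, h, h, .ref .refl rfl⟩
  | arrow => exact h.2.1

theorem Shape.reflPath_reds (θ : Shape) : θ.toTm.reflPath.Reds (.ref θ.toTm) := by
  induction θ with
  | bot => exact .refl
  | imp a b iha ihb => exact (iha.imp ihb).tail (.refRef _ _)

theorem Ty.pth_reflPath {A : Ty} {M : Tm} (h : A.sem.tm M) : A.sem.pth M.reflPath M M := by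
  cases A with
  | Omega =>
    obtain ⟨θ, h⟩ := h
    have hr : M.reflPath.Reds θ.toTm.reflPath :=
      Relation.ReflTransGen.lift Tm.reflPath (p := Pth.Red)
        (fun _ _ k => Tm.Red.pathSubst k _ _ _) _ _ h
    exact ⟨θ, θ, h, h, .ref (hr.trans θ.reflPath_reds) rfl⟩
  | arrow => exact h.2.2

/-! ### The interpretation of judgements -/

/-- The substitution `s` instantiates the term variables of `Γ` by computable terms. -/
def Ctx.TmSub (Γ : Ctx) (s : ℕ → Tm) : Prop := ∀ x A, Γ.HasTm x A → A.sem.tm (s x)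

/-- The substitution `σ` instantiates all variables of `Γ` by computable expressions. -/
structure Ctx.CompSub (Γ : Ctx) (σ : Sub) : Prop where
  tm : Γ.TmSub σ.tm
  prf : ∀ p φ, Γ.HasPrf p φ → (σ.prf p).CompAt (φ.subst σ.tm)
  pth : ∀ e M A N, Γ.HasPth e M A N → A.sem.pth (σ.pth e) (M.subst σ.tm) (N.subst σ.tm)

/-- `τ : ρ = σ` instantiates the term variables of `Γ` by computable paths between computable
terms. -/
structure Ctx.PathSub (Γ : Ctx) (τ : ℕ → Pth) (ρ σ : ℕ → Tm) : Prop where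
  left : Γ.TmSub ρ
  right : Γ.TmSub σ
  pth : ∀ x A, Γ.HasTm x A → A.sem.pth (τ x) (ρ x) (σ x)

/-- `M` is computable at `A` under all computable substitutions and path substitutions. -/
structure Ctx.ValidTm (Γ : Ctx) (M : Tm) (A : Ty) : Prop where
  subst : ∀ s, Γ.TmSub s → A.sem.tm (M.subst s)
  path : ∀ τ ρ σ, Γ.PathSub τ ρ σ → A.sem.pth (M.pathSubst τ ρ σ) (M.subst ρ) (M.subst σ)

/-- Every proposition, and every endpoint of an equation, declared in `Γ` is valid. -/
def Ctx.Valid : Ctx → Prop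
  | .nil => True
  | .tm Γ _ => Γ.Valid
  | .prf Γ φ => Γ.Valid ∧ Γ.ValidTm φ .Omega
  | .pth Γ M A N => Γ.Valid ∧ Γ.ValidTm M A ∧ Γ.ValidTm N A

/-- The semantic counterpart of the judgement `Γ ⊢ J`. -/
def Jdg.Valid (Γ : Ctx) : Jdg → Prop
  | .valid => True
  | .tm M A => Γ.ValidTm M A
  | .prf δ φ => ∀ σ, Γ.CompSub σ → (δ.subst σ).CompAt (φ.subst σ.tm)
  | .pth P M A N => ∀ σ, Γ.CompSub σ → A.sem.pth (P.subst σ) (M.subst σ.tm) (N.subst σ.tm)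

theorem Ctx.TmSub.cons {Γ : Ctx} {s : ℕ → Tm} {A : Ty} {N : Tm} (h : Γ.TmSub s)
    (hN : A.sem.tm N) : (Ctx.tm Γ A).TmSub (cons N s) := by
  intro x B hx
  cases hx with
  | here => exact hN
  | tm _ hx => exact h _ _ hx

theorem Ctx.PathSub.cons {Γ : Ctx} {τ : ℕ → Pth} {ρ σ : ℕ → Tm} {A : Ty} {N N' : Tm} {Q : Pth}
    (h : Γ.PathSub τ ρ σ) (hN : A.sem.tm N) (hN' : A.sem.tm N') (hQ : A.sem.pth Q N N') :
    (Ctx.tm Γ A).PathSub (PHOML.cons Q τ) (PHOML.cons N ρ) (PHOML.cons N' σ) := by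
  refine ⟨h.left.cons hN, h.right.cons hN', fun x B hx => ?_⟩
  cases hx with
  | here => exact hQ
  | tm _ hx => exact h.pth _ _ hx

/-- A computable substitution followed by `{}` is a computable path substitution. -/
theorem Ctx.TmSub.pathSub {Γ : Ctx} {s : ℕ → Tm} (h : Γ.TmSub s) :
    Γ.PathSub (fun x => (s x).reflPath) s s :=
  ⟨h, h, fun x A hx => Ty.pth_reflPath (h x A hx)⟩

theorem Ctx.CompSub.consPrf {Γ : Ctx} {σ : Sub} {φ : Tm} {ε : Prf} (h : Γ.CompSub σ)
    (hε : ε.CompAt (φ.subst σ.tm)) : (Ctx.prf Γ φ).CompSub (σ.consPrf ε) where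
  tm x A hx := by
    cases hx with
    | prf _ hx => exact h.tm _ _ hx
  prf p ψ hp := by
    cases hp with
    | here => exact hε
    | prf _ hp => exact h.prf _ _ hp
  pth e M A N he := by
    cases he with
    | prf _ he => exact h.pth _ _ _ _ he

theorem Ctx.CompSub.consLll {Γ : Ctx} {σ : Sub} {A : Ty} {L L' : Tm} {Q : Pth}
    (h : Γ.CompSub σ) (hL : A.sem.tm L) (hL' : A.sem.tm L') (hQ : A.sem.pth Q L L') :
    (Ctx.pth (.tm (.tm Γ A) A) (.var 1) A (.var 0)).CompSub (σ.consLll L L' Q) where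
  tm x B hx := by
    cases hx with
    | pth _ _ _ hx => exact (h.tm.cons hL).cons hL' _ _ hx
  prf p ψ hp := by
    cases hp with
    | pth _ _ _ hp =>
      cases hp with
      | tm _ hp =>
        cases hp with
        | tm _ hp =>
          simp only [Sub.consLll, Tm.wk_subst_cons]
          exact h.prf _ _ hp
  pth e M B N he := by
    cases he with
    | here => exact hQ
    | pth _ _ _ he =>
      cases he with
      | tm _ he =>
        cases he with
        | tm _ he =>
          simp only [Sub.consLll, Tm.wk_subst_cons]
          exact h.pth _ _ _ _ he

/-! ### Soundness -/

theorem Ctx.ValidTm.imp {Γ : Ctx} {φ ψ : Tm} (h : Γ.ValidTm φ .Omega) (k : Γ.ValidTm ψ .Omega) :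
    Γ.ValidTm (.imp φ ψ) .Omega where
  subst s hs := by
    obtain ⟨θ, hθ⟩ := h.subst s hs
    obtain ⟨θ', hθ'⟩ := k.subst s hs
    exact ⟨_, hθ.imp hθ'⟩
  path τ ρ σ ht := by
    obtain ⟨θ₁, θ₁', h₁, h₁', hp⟩ := h.path τ ρ σ ht
    obtain ⟨θ₂, θ₂', h₂, h₂', kp⟩ := k.path τ ρ σ ht
    exact ⟨_, _, h₁.imp h₂, h₁'.imp h₂', hp.imp kp⟩

theorem Ctx.ValidTm.app {Γ : Ctx} {M N : Tm} {A B : Ty} (h : Γ.ValidTm M (.arrow A B))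
    (k : Γ.ValidTm N A) : Γ.ValidTm (.app M N) B where
  subst s hs := (h.subst s hs).1 _ (k.subst s hs)
  path τ ρ σ ht :=
    (h.path τ ρ σ ht).2 _ _ _ (k.subst ρ ht.left) (k.subst σ ht.right) (k.path τ ρ σ ht)

theorem Tm.conv_beta (A : Ty) (M N : Tm) (s : ℕ → Tm) :
    Tm.Conv (M.subst (cons N s)) (.app (.lam A (M.subst (Tm.upSub s))) N) := by
  rw [← Tm.upSub_inst]
  exact .symm _ _ (.rel _ _ (.beta A _ N))

/-- The abstraction is computable because all three contracta, those of `(λx:A.M)N`, of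
`ref (λx:A.M)` applied to a path and of `(λx:A.M){τ : ρ = σ}` applied to a path, are instances
of `M` under extended substitutions. -/
theorem Ctx.ValidTm.lam {Γ : Ctx} {M : Tm} {A B : Ty} (h : (Ctx.tm Γ A).ValidTm M B) :
    Γ.ValidTm (.lam A M) (.arrow A B) := by
  have path : ∀ τ ρ σ, Γ.PathSub τ ρ σ → (Ty.arrow A B).sem.pth
      ((Tm.lam A M).pathSubst τ ρ σ) ((Tm.lam A M).subst ρ) ((Tm.lam A M).subst σ) := by
    intro τ ρ σ ht
    refine ⟨⟨_, .refl, .inr (.lll _ _)⟩, fun L L' Q hL hL' hQ => ?_⟩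
    refine Ty.pth_expand (.single (.beta _ _ _ _ _)) ?_
    rw [Tm.pathSubst_triple]
    exact Ty.pth_conv (h.path _ _ _ (ht.cons hL hL' hQ)) (Tm.conv_beta A M L ρ)
      (Tm.conv_beta A M L' σ)
  refine ⟨fun s hs => ⟨fun N hN => ?_, ⟨⟨_, .refl, .inr (.ref _)⟩, ?_⟩, ?_⟩, path⟩
  · refine Ty.tm_expand (.beta _ _ _) ?_
    rw [Tm.upSub_inst]
    exact h.subst _ (hs.cons hN)
  · intro L L' Q hL hL' hQ
    refine Ty.pth_expand (.single (.refLam _ _ _ _ _)) ?_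
    rw [Tm.upSub_pathInst]
    exact Ty.pth_conv (h.path _ _ _ (hs.pathSub.cons hL hL' hQ)) (Tm.conv_beta A M L s)
      (Tm.conv_beta A M L' s)
  · have hp := path _ _ _ hs.pathSub
    rw [← Tm.subst_reflPath] at hp
    exact hp

theorem Prf.CompAt.app {δ ε : Prf} {φ ψ : Tm} (h : δ.CompAt (.imp φ ψ)) (k : ε.CompAt φ) :
    (Prf.app δ ε).CompAt ψ := by
  obtain ⟨_, hs, h⟩ := h
  obtain ⟨θ₁, θ₂, rfl, h₁, h₂⟩ := hs.imp_inv
  obtain ⟨θ, k₁, k⟩ := k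
  cases k₁.unique h₁
  exact ⟨θ₂, h₂, h.2 _ k⟩

theorem Prf.CompAt.lam {δ : Prf} {φ ψ : Tm} (hφ : ∃ θ, φ.HasShape θ)
    (h : ∀ ε, ε.CompAt φ → (δ.subst (Sub.singlePrf ε)).CompAt ψ) :
    (Prf.lam φ δ).CompAt (.imp φ ψ) := by
  obtain ⟨θ, hθ⟩ := hφ
  -- a neutral proof is computable, so that `h` provides the shape of `ψ`
  obtain ⟨θ', hθ', -⟩ := h (.var 0) ⟨θ, hθ, θ.comp_of_neutral (.var 0)⟩
  refine ⟨_, hθ.imp hθ', Shape.comp_lam fun ε hε => ?_⟩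
  obtain ⟨θ'', k, hk⟩ := h ε ⟨θ, hθ, hε⟩
  cases k.unique hθ'
  exact hk

theorem Prf.CompAt.conv {δ : Prf} {φ ψ : Tm} (h : δ.CompAt φ) (hc : Tm.Conv φ ψ) :
    δ.CompAt ψ := by
  obtain ⟨θ, hθ, h⟩ := h
  exact ⟨θ, (hc.hasShape_iff θ).1 hθ, h⟩

theorem Pth.comp_univ {φ ψ : Tm} {δ ε : Prf} (φ' ψ' : Tm) (h : δ.CompAt (.imp φ ψ))
    (k : ε.CompAt (.imp ψ φ)) : Ty.Omega.sem.pth (.univ φ' ψ' δ ε) φ ψ := by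
  obtain ⟨_, hs, h⟩ := h
  obtain ⟨θ₁, θ₂, rfl, h₁, h₂⟩ := hs.imp_inv
  obtain ⟨_, ks, k⟩ := k
  obtain ⟨θ₃, θ₄, rfl, h₃, h₄⟩ := ks.imp_inv
  cases h₃.unique h₂
  cases h₄.unique h₁
  exact ⟨_, _, h₁, h₂, .univ .refl h k⟩

/-- Every derivable judgement is valid.  Validity of the context is carried along because the
case of `λp:φ.δ` needs the computability of `φ`, which is a premise only of the rule that
declares `p`. -/
theorem Derives.sound {Γ : Ctx} {J : Jdg} (h : Derives Γ J) : Γ.Valid ∧ J.Valid Γ := by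
  induction h with
  | ctxNil => exact ⟨trivial, trivial⟩
  | ctxT A _ ih => exact ⟨ih.1, trivial⟩
  | ctxP _ ih => exact ⟨ih, trivial⟩
  | ctxE _ _ ih₁ ih₂ => exact ⟨⟨ih₁.1, ih₁.2, ih₂.2⟩, trivial⟩
  | varT _ hx ih => exact ⟨ih.1, fun s hs => hs _ _ hx, fun τ ρ σ ht => ht.pth _ _ hx⟩
  | varP _ hp ih => exact ⟨ih.1, fun σ hσ => hσ.prf _ _ hp⟩
  | varE _ he ih => exact ⟨ih.1, fun σ hσ => hσ.pth _ _ _ _ he⟩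
  | bot _ ih =>
    exact ⟨ih.1, fun s _ => ⟨.bot, .refl⟩,
      fun _ _ _ _ => ⟨.bot, .bot, .refl, .refl, .ref .refl rfl⟩⟩
  | imp _ _ ih₁ ih₂ => exact ⟨ih₁.1, ih₁.2.imp ih₂.2⟩
  | appT _ _ ih₁ ih₂ => exact ⟨ih₁.1, ih₁.2.app ih₂.2⟩
  | lamT _ ih => exact ⟨ih.1, ih.2.lam⟩
  | appP _ _ ih₁ ih₂ => exact ⟨ih₁.1, fun σ hσ => (ih₁.2 σ hσ).app (ih₂.2 σ hσ)⟩
  | lamP _ ih =>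
    refine ⟨ih.1.1, fun σ hσ => Prf.CompAt.lam (ih.1.2.subst _ hσ.tm) fun ε hε => ?_⟩
    rw [Prf.upPrf_singlePrf]
    exact ih.2 _ (hσ.consPrf hε)
  | convP _ _ hc ih _ => exact ⟨ih.1, fun σ hσ => (ih.2 σ hσ).conv (hc.subst _)⟩
  | ref _ ih => exact ⟨ih.1, fun σ hσ => Ty.pth_ref (ih.2.subst _ hσ.tm)⟩
  | impE _ _ ih₁ ih₂ =>
    refine ⟨ih₁.1, fun σ hσ => ?_⟩
    obtain ⟨θ₁, θ₁', h₁, h₁', hp⟩ := ih₁.2 σ hσ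
    obtain ⟨θ₂, θ₂', h₂, h₂', kp⟩ := ih₂.2 σ hσ
    exact ⟨_, _, h₁.imp h₂, h₁'.imp h₂', hp.imp kp⟩
  | univ _ _ ih₁ ih₂ =>
    exact ⟨ih₁.1, fun σ hσ => Pth.comp_univ _ _ (ih₁.2 σ hσ) (ih₂.2 σ hσ)⟩
  | plus _ ih =>
    refine ⟨ih.1, fun σ hσ => ?_⟩
    obtain ⟨_, _, h₁, h₂, h⟩ := ih.2 σ hσ
    exact ⟨_, h₁.imp h₂, h.plus⟩
  | minus _ ih =>
    refine ⟨ih.1, fun σ hσ => ?_⟩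
    obtain ⟨_, _, h₁, h₂, h⟩ := ih.2 σ hσ
    exact ⟨_, h₂.imp h₁, h.minus⟩
  | lll _ _ _ ih₁ ih₂ _ =>
    refine ⟨ih₂.1, fun σ hσ => ⟨⟨_, .refl, .inr (.lll _ _)⟩, fun L L' Q hL hL' hQ => ?_⟩⟩
    refine Ty.pth_expand (.single (.beta _ _ _ _ _)) ?_
    rw [Pth.upLll_triple]
    have h := ih₁.2 _ (hσ.consLll hL hL' hQ)
    simp only [Tm.subst, Sub.consLll, Tm.wk_subst_cons] at h
    exact h
  | appE _ _ _ _ ih₁ ih₂ ih₃ ih₄ =>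
    exact ⟨ih₁.1, fun σ hσ => (ih₁.2 σ hσ).2 _ _ _ (ih₃.2.subst _ hσ.tm)
      (ih₄.2.subst _ hσ.tm) (ih₂.2 σ hσ)⟩
  | convE _ _ _ hM hN ih _ _ =>
    exact ⟨ih.1, fun σ hσ => Ty.pth_conv (ih.2 σ hσ) (hM.subst _) (hN.subst _)⟩

/-! ### The identity substitution -/

theorem Ctx.NoTmVar.tmSub {Γ : Ctx} (hΓ : Γ.NoTmVar) (s : ℕ → Tm) : Γ.TmSub s := by
  intro x A hx
  induction hx with
  | here => exact hΓ.elim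
  | tm => exact hΓ.elim
  | prf _ _ ih => exact ih hΓ
  | pth _ _ _ _ ih => exact ih hΓ

theorem Ctx.ValidTm.comp {Γ : Ctx} {M : Tm} {A : Ty} (h : Γ.ValidTm M A) (hΓ : Γ.NoTmVar) :
    A.sem.tm M := by
  have := h.subst _ (hΓ.tmSub Tm.var)
  rwa [Tm.subst_var] at this

theorem Ctx.HasPrf.comp {Γ : Ctx} {p : ℕ} {φ : Tm} (hp : Γ.HasPrf p φ) (hΓ : Γ.NoTmVar)
    (h : Γ.Valid) : Ty.Omega.sem.tm φ := by
  induction hp with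
  | here => exact h.2.comp hΓ
  | tm => exact hΓ.elim
  | prf _ _ ih => exact ih hΓ h.1
  | pth _ _ _ _ ih => exact ih hΓ h.1

theorem Ctx.HasPth.comp {Γ : Ctx} {e : ℕ} {M : Tm} {A : Ty} {N : Tm}
    (he : Γ.HasPth e M A N) (hΓ : Γ.NoTmVar) (h : Γ.Valid) : A.sem.tm M ∧ A.sem.tm N := by
  induction he with
  | here => exact ⟨h.2.1.comp hΓ, h.2.2.comp hΓ⟩
  | tm => exact hΓ.elim
  | prf _ _ ih => exact ih hΓ h.1
  | pth _ _ _ _ ih => exact ih hΓ h.1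

/-- Without term variables the identity substitution is computable: proof and path variables are
neutral, and the propositions and endpoints that they are declared with are computable. -/
theorem Ctx.Valid.compSub_ident {Γ : Ctx} (h : Γ.Valid) (hΓ : Γ.NoTmVar) :
    Γ.CompSub Sub.ident where
  tm := hΓ.tmSub _
  prf p φ hp := by
    obtain ⟨θ, hθ⟩ := hp.comp hΓ h
    refine ⟨θ, ?_, θ.comp_of_neutral (.var p)⟩
    simpa only [Sub.ident, Tm.subst_var] using hθ
  pth e M A N he := by
    obtain ⟨hM, hN⟩ := he.comp hΓ h
    simp only [Sub.ident, Tm.subst_var]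
    exact Ty.pth_of_neutral (.var e) hM hN

end PHOML

theorem mainTheorem3 (Γ : PHOML.Ctx) (hΓ : Γ.NoTmVar) :
    (∀ (δ : PHOML.Prf) (φ : PHOML.Tm), PHOML.Derives Γ (.prf δ φ) →
      ∃ δ' : PHOML.Prf, δ.Reds δ' ∧ (δ'.Neutral ∨ δ'.Canonical)) ∧
    (∀ (P : PHOML.Pth) (M : PHOML.Tm) (A : PHOML.Ty) (N : PHOML.Tm),
      PHOML.Derives Γ (.pth P M A N) →
      ∃ P' : PHOML.Pth, P.Reds P' ∧ (P'.Neutral ∨ P'.Canonical)) := by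
  constructor
  · intro δ φ h
    obtain ⟨hv, hJ⟩ := h.sound
    obtain ⟨θ, -, hc⟩ := hJ _ (hv.compSub_ident hΓ)
    rw [PHOML.Prf.subst_ident] at hc
    exact hc.wn
  · intro P M A N h
    obtain ⟨hv, hJ⟩ := h.sound
    have hc := hJ _ (hv.compSub_ident hΓ)
    rw [PHOML.Pth.subst_ident] at hc
    exact PHOML.Ty.pth_wn hc
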